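/- Let $a_1<a_2<a_3<a_4$ be real numbers, $P(x)=\prod_{i=1}^4(x-a_i)$, $\sigma=\frac14\sum_{i=1}^4 a_i$, and $$L\psi:=(P\psi')'+2(x-\sigma)^2\psi .$$ For $I_j=(a_j,a_{j+1})$, $j=2,3$, let $D_{j,\max}$ be the set of all $\psi:I_j\to\mathbb C$ such that $\psi$ and $P\psi'$ are absolutely continuous on every compact subinterval of $I_j$ and $\psi,L\psi\in L^2(I_j)$, and let $D_{j,\min}$ be the set of those $\psi\in D_{j,\max}$ whose support (closure in $\mathbb R$ of the set where $\psi\neq0$) is contained in $I_j$. Put $D_{\max}=D_{2,\max}+D_{3,\max}$ and $D_{\min}=D_{2,\min}+D_{3,\min}$, considered as subspaces of $L^2(a_2,a_4)$, and let $L_{\max}$, $L_{\min}$ be the operators in $L^2(a_2,a_4)$ with domains $D_{\max}$, $D_{\min}$ that act as $L$ on each of the two intervals. For functions $f,g$ let $$[f,g]:=f\,P\,\overline{g}'-\overline{g}\,P f',$$ and write $[f,g](a_i^{\pm})$ for its one-sided limits at $a_i$, which exist and are finite for $f,g\in D_{\max}$. Let $$u(y):=1,\qquad v(y):=\sum_{i=1}^4\Big(\prod_{j\ne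 i}\frac1{a_i-a_j}\Big)\ln|y-a_i| .$$ Then $u,v\in D_{\max}$, and the operator $L_S$ in $L^2(a_2,a_4)$ that acts as $L_{\max}$ on the domain $$D(L_S):=\{\psi\in D_{\max}:\ [\psi,u](a_2^+)=[\psi,u](a_4^-)=0,\ [\psi,u](a_3^-)=[\psi,u](a_3^+),\ [\psi,v](a_3^-)=[\psi,v](a_3^+)\}$$ is densely defined, extends $L_{\min}$ (and the closure of $L_{\min}$), and is self-adjoint. -/

import Mathlib

open MeasureTheory Set Filter Topology

namespace TwoIntervalSL

/-! The points `a₁ < a₂ < a₃ < a₄` are `a 0 < a 1 < a 2 < a 3`; the two intervals are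
`(a 1, a 2)` and `(a 2, a 3)`. A function on an interval is a function `ℝ → ℂ` of which only the
values on the open interval matter. -/

/-- `P(x) = ∏ᵢ (x - aᵢ)`. -/
noncomputable def P (a : Fin 4 → ℝ) (x : ℝ) : ℝ := ∏ i, (x - a i)

/-- `σ = (a₁ + a₂ + a₃ + a₄) / 4`. -/
noncomputable def sigma (a : Fin 4 → ℝ) : ℝ := (1 / 4) * ∑ i, a i

/-- The quasi-derivative `P ψ'`. -/
noncomputable def quasiDeriv (a : Fin 4 → ℝ) (ψ : ℝ → ℂ) (x : ℝ) : ℂ :=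
  (P a x : ℂ) * deriv ψ x

/-- The differential expression `L ψ = (P ψ')' + 2 (x - σ)² ψ`. -/
noncomputable def diffExpr (a : Fin 4 → ℝ) (ψ : ℝ → ℂ) (x : ℝ) : ℂ :=
  deriv (quasiDeriv a ψ) x + 2 * ((x : ℂ) - (sigma a : ℂ)) ^ 2 * ψ x

/-- `f` is absolutely continuous on every compact subinterval of the open interval `(α, β)`. -/
def ACLoc (f : ℝ → ℂ) (α β : ℝ) : Prop :=
  ∀ c d, α < c → c ≤ d → d < β → AbsolutelyContinuousOnInterval f c d

/-- The functions of the maximal domain of `L` on the interval `(α, β)`. -/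
structure IsMaxFunOn (a : Fin 4 → ℝ) (α β : ℝ) (ψ : ℝ → ℂ) : Prop where
  ac : ACLoc ψ α β
  ac_quasiDeriv : ACLoc (quasiDeriv a ψ) α β
  memLp : MemLp ψ 2 (volume.restrict (Ioo α β))
  memLp_diffExpr : MemLp (diffExpr a ψ) 2 (volume.restrict (Ioo α β))

/-- The functions of the maximal domain of the two-interval problem on
`(a₂, a₃) ∪ (a₃, a₄)`. -/
structure IsMaxFun (a : Fin 4 → ℝ) (ψ : ℝ → ℂ) : Prop where
  left : IsMaxFunOn a (a 1) (a 2) ψ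
  right : IsMaxFunOn a (a 2) (a 3) ψ

/-- The functions of the minimal domain: those of the maximal domain whose support
(the closure, in `ℝ`, of the set where they do not vanish) on each of the two open intervals is
contained in that open interval. -/
structure IsMinFun (a : Fin 4 → ℝ) (ψ : ℝ → ℂ) : Prop where
  max : IsMaxFun a ψ
  supp_left : closure (Function.support ψ ∩ Ioo (a 1) (a 2)) ⊆ Ioo (a 1) (a 2)
  supp_right : closure (Function.support ψ ∩ Ioo (a 2) (a 3)) ⊆ Ioo (a 2) (a 3)

/-- The Lagrange sesquilinear form `[f, g] = f P ḡ' - ḡ P f'`. -/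
noncomputable def bracket (a : Fin 4 → ℝ) (f g : ℝ → ℂ) (x : ℝ) : ℂ :=
  f x * (P a x : ℂ) * deriv (fun y => (starRingEnd ℂ) (g y)) x
    - (starRingEnd ℂ) (g x) * (P a x : ℂ) * deriv f x

/-- The function `u = 1`. -/
noncomputable def u : ℝ → ℂ := fun _ => 1

/-- The function `v(y) = ∑ᵢ (∏_{j ≠ i} 1 / (aᵢ - aⱼ)) ln |y - aᵢ|`. -/
noncomputable def v (a : Fin 4 → ℝ) : ℝ → ℂ := fun y =>
  ((∑ i, (∏ j ∈ Finset.univ.erase i, 1 / (a i - a j)) * Real.log |y - a i| : ℝ) : ℂ)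

/-- The functions of the domain of `L_S`: functions of the maximal domain which satisfy the
boundary conditions at `a₂⁺`, `a₄⁻` and the transmission conditions at `a₃`. -/
structure IsSFun (a : Fin 4 → ℝ) (ψ : ℝ → ℂ) : Prop where
  max : IsMaxFun a ψ
  bc_left : Tendsto (bracket a ψ u) (𝓝[>] (a 1)) (𝓝 0)
  bc_right : Tendsto (bracket a ψ u) (𝓝[<] (a 3)) (𝓝 0)
  trans_u : ∃ l : ℂ, Tendsto (bracket a ψ u) (𝓝[<] (a 2)) (𝓝 l) ∧
    Tendsto (bracket a ψ u) (𝓝[>] (a 2)) (𝓝 l)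
  trans_v : ∃ l : ℂ, Tendsto (bracket a ψ (v a)) (𝓝[<] (a 2)) (𝓝 l) ∧
    Tendsto (bracket a ψ (v a)) (𝓝[>] (a 2)) (𝓝 l)

/-- Lebesgue measure on `(a₂, a₄)`. -/
noncomputable abbrev mu (a : Fin 4 → ℝ) : Measure ℝ := volume.restrict (Ioo (a 1) (a 3))

/-- The Hilbert space `L²(a₂, a₄)` of complex-valued functions. -/
noncomputable abbrev H (a : Fin 4 → ℝ) : Type := Lp ℂ 2 (mu a)

/-! ### Regularity and linearity of the differential expression -/

theorem P_ne_zero_left {a : Fin 4 → ℝ} (ha : StrictMono a) {x : ℝ}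
    (hx : x ∈ Ioo (a 1) (a 2)) : P a x ≠ 0 := by
  have h0 : a 0 < a 1 := ha (by decide)
  have h2 : a 2 < a 3 := ha (by decide)
  have e0 : x - a 0 ≠ 0 := sub_ne_zero.2 (h0.trans hx.1).ne'
  have e1 : x - a 1 ≠ 0 := sub_ne_zero.2 hx.1.ne'
  have e2 : x - a 2 ≠ 0 := sub_ne_zero.2 hx.2.ne
  have e3 : x - a 3 ≠ 0 := sub_ne_zero.2 (hx.2.trans h2).ne
  simp [P, Fin.prod_univ_four, e0, e1, e2, e3]

theorem P_ne_zero_right {a : Fin 4 → ℝ} (ha : StrictMono a) {x : ℝ}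
    (hx : x ∈ Ioo (a 2) (a 3)) : P a x ≠ 0 := by
  have h0 : a 0 < a 2 := ha (by decide)
  have h1 : a 1 < a 2 := ha (by decide)
  have e0 : x - a 0 ≠ 0 := sub_ne_zero.2 (h0.trans hx.1).ne'
  have e1 : x - a 1 ≠ 0 := sub_ne_zero.2 (h1.trans hx.1).ne'
  have e2 : x - a 2 ≠ 0 := sub_ne_zero.2 hx.1.ne'
  have e3 : x - a 3 ≠ 0 := sub_ne_zero.2 hx.2.ne
  simp [P, Fin.prod_univ_four, e0, e1, e2, e3]

theorem continuous_P (a : Fin 4 → ℝ) : Continuous (P a) := by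
  unfold P; fun_prop

theorem ACLoc.continuousOn {f : ℝ → ℂ} {α β : ℝ} (hf : ACLoc f α β) :
    ContinuousOn f (Ioo α β) := by
  intro x hx
  obtain ⟨c, hc, hcx⟩ := exists_between hx.1
  obtain ⟨d, hxd, hd⟩ := exists_between hx.2
  have hcd : c ≤ d := (hcx.trans hxd).le
  have h := (hf c d hc hcd hd).continuousOn
  rw [uIcc_of_le hcd] at h
  exact (h.continuousAt (Icc_mem_nhds hcx hxd)).continuousWithinAt

theorem ACLoc.ae_differentiableAt {f : ℝ → ℂ} {α β : ℝ} (hf : ACLoc f α β) :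
    ∀ᵐ x, x ∈ Ioo α β → DifferentiableAt ℝ f x := by
  have h : LocallyBoundedVariationOn f (Ioo α β) := by
    intro c d hc hd
    rcases le_or_gt c d with hcd | hcd
    · refine (hf c d hc.1 hcd hd.2).boundedVariationOn.mono ?_
      rw [uIcc_of_le hcd]
      exact inter_subset_right
    · rw [Icc_eq_empty (not_le.2 hcd), inter_empty]
      simp [BoundedVariationOn]
  filter_upwards [h.ae_differentiableWithinAt_of_mem] with x hx hxs
  exact (hx hxs).differentiableAt (Ioo_mem_nhds hxs.1 hxs.2)

theorem ACLoc.congr {f g : ℝ → ℂ} {α β : ℝ} (hf : ACLoc f α β)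
    (h : ∀ x ∈ Ioo α β, g x = f x) : ACLoc g α β := by
  intro c d hc hcd hd
  have hf' := hf c d hc hcd hd
  rw [absolutelyContinuousOnInterval_iff] at hf' ⊢
  intro ε hε
  obtain ⟨δ, hδ, H⟩ := hf' ε hε
  refine ⟨δ, hδ, fun E hE hlt => ?_⟩
  have hI : ∀ y ∈ uIcc c d, g y = f y := fun y hy => by
    rw [uIcc_of_le hcd] at hy
    exact h y ⟨hc.trans_le hy.1, hy.2.trans_lt hd⟩
  have := H E hE hlt
  rwa [Finset.sum_congr rfl fun i hi => by
    rw [hI _ (hE.1 i hi).1, hI _ (hE.1 i hi).2]]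

theorem IsMaxFunOn.differentiableAt {a : Fin 4 → ℝ} {α β : ℝ} {ψ : ℝ → ℂ}
    (hP : ∀ x ∈ Ioo α β, P a x ≠ 0) (h : IsMaxFunOn a α β ψ) {x : ℝ} (hx : x ∈ Ioo α β) :
    DifferentiableAt ℝ ψ x := by
  obtain ⟨c, hc, hcx⟩ := exists_between hx.1
  obtain ⟨d, hxd, hd⟩ := exists_between hx.2
  have hcd : c ≤ d := (hcx.trans hxd).le
  have hsub : Icc c d ⊆ Ioo α β := fun y hy => ⟨hc.trans_le hy.1, hy.2.trans_lt hd⟩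
  have hq : ContinuousOn (deriv ψ) (Ioo α β) := by
    have h1 : ContinuousOn (fun y => ((P a y : ℂ))⁻¹ * quasiDeriv a ψ y) (Ioo α β) := by
      refine ContinuousOn.mul (ContinuousOn.inv₀ ?_ ?_) h.ac_quasiDeriv.continuousOn
      · exact (Complex.continuous_ofReal.comp (continuous_P a)).continuousOn
      · intro y hy
        exact_mod_cast hP y hy
    refine h1.congr fun y hy => ?_
    have : (P a y : ℂ) ≠ 0 := by exact_mod_cast hP y hy
    simp only [quasiDeriv]
    field_simp
  have hF : ∀ y ∈ Ioo α β, HasDerivAt (fun z => ∫ t in c..z, deriv ψ t) (deriv ψ y) y := by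
    intro y hy
    refine intervalIntegral.integral_hasDerivAt_right ?_ ?_ ?_
    · refine (hq.mono ?_).intervalIntegrable
      exact (ordConnected_Ioo.uIcc_subset ⟨hc, hcx.trans hx.2⟩ hy)
    · exact hq.stronglyMeasurableAtFilter isOpen_Ioo y hy
    · exact hq.continuousAt (Ioo_mem_nhds hy.1 hy.2)
  have hFac : AbsolutelyContinuousOnInterval (fun z => ∫ t in c..z, deriv ψ t) c d := by
    refine ContDiffOn.absolutelyContinuousOnInterval ?_
    rw [uIcc_of_le hcd]
    refine ContDiffOn.mono (s := Ioo α β) ?_ hsub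
    rw [show (1 : WithTop ℕ∞) = 0 + 1 from (zero_add 1).symm,
      contDiffOn_succ_iff_deriv_of_isOpen isOpen_Ioo]
    refine ⟨fun y hy => (hF y hy).differentiableAt.differentiableWithinAt, by simp, ?_⟩
    rw [contDiffOn_zero]
    exact hq.congr fun y hy => (hF y hy).deriv
  obtain ⟨C, hC⟩ := ((h.ac c d hc hcd hd).sub hFac).const_of_ae_hasDerivAt_zero (by
    filter_upwards [h.ac.ae_differentiableAt] with y hy hyI
    rw [uIcc_of_le hcd] at hyI
    have := (hy (hsub hyI)).hasDerivAt.sub (hF y (hsub hyI))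
    rwa [sub_self] at this)
  have hev : ψ =ᶠ[𝓝 x] fun z => C + ∫ t in c..z, deriv ψ t := by
    filter_upwards [Icc_mem_nhds hcx hxd] with y hy
    have := hC y (by rwa [uIcc_of_le hcd])
    simp only [Pi.sub_apply] at this
    rw [← this]; ring
  exact ((hF x hx).differentiableAt.const_add C).congr_of_eventuallyEq hev

theorem diffExpr_congr {a : Fin 4 → ℝ} {α β : ℝ} {ψ φ : ℝ → ℂ}
    (h : ∀ x ∈ Ioo α β, ψ x = φ x) {x : ℝ} (hx : x ∈ Ioo α β) :
    diffExpr a ψ x = diffExpr a φ x := by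
  have h1 : ψ =ᶠ[𝓝 x] φ := by
    filter_upwards [Ioo_mem_nhds hx.1 hx.2] with y hy using h y hy
  have h2 : quasiDeriv a ψ =ᶠ[𝓝 x] quasiDeriv a φ := by
    filter_upwards [h1.deriv] with y hy
    simp only [quasiDeriv, hy]
  simp only [diffExpr, h2.deriv_eq, h1.eq_of_nhds]

theorem quasiDeriv_lin {a : Fin 4 → ℝ} {α β : ℝ} {ψ φ : ℝ → ℂ}
    (hP : ∀ x ∈ Ioo α β, P a x ≠ 0) (hψ : IsMaxFunOn a α β ψ) (hφ : IsMaxFunOn a α β φ)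
    (k : ℂ) {x : ℝ} (hx : x ∈ Ioo α β) :
    quasiDeriv a (k • ψ + φ) x = (k • quasiDeriv a ψ + quasiDeriv a φ) x := by
  have h1 := hψ.differentiableAt hP hx
  have h2 := hφ.differentiableAt hP hx
  simp only [quasiDeriv, Pi.add_apply, Pi.smul_apply, smul_eq_mul]
  rw [deriv_add (h1.const_smul k) h2, deriv_const_smul _ h1, smul_eq_mul]
  ring

theorem diffExpr_lin {a : Fin 4 → ℝ} {α β : ℝ} {ψ φ : ℝ → ℂ}
    (hP : ∀ x ∈ Ioo α β, P a x ≠ 0) (hψ : IsMaxFunOn a α β ψ) (hφ : IsMaxFunOn a α β φ)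
    (k : ℂ) : ∀ᵐ x, x ∈ Ioo α β →
      diffExpr a (k • ψ + φ) x = (k • diffExpr a ψ + diffExpr a φ) x := by
  filter_upwards [hψ.ac_quasiDeriv.ae_differentiableAt,
    hφ.ac_quasiDeriv.ae_differentiableAt] with x h1 h2 hx
  have hev : quasiDeriv a (k • ψ + φ) =ᶠ[𝓝 x] k • quasiDeriv a ψ + quasiDeriv a φ := by
    filter_upwards [Ioo_mem_nhds hx.1 hx.2] with y hy using quasiDeriv_lin hP hψ hφ k hy
  simp only [diffExpr, Pi.add_apply, Pi.smul_apply, smul_eq_mul]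
  rw [hev.deriv_eq, deriv_add ((h1 hx).const_smul k) (h2 hx), deriv_const_smul _ (h1 hx),
    smul_eq_mul]
  ring

theorem IsMaxFunOn.lin {a : Fin 4 → ℝ} {α β : ℝ} {ψ φ : ℝ → ℂ}
    (hP : ∀ x ∈ Ioo α β, P a x ≠ 0) (hψ : IsMaxFunOn a α β ψ) (hφ : IsMaxFunOn a α β φ)
    (k : ℂ) : IsMaxFunOn a α β (k • ψ + φ) where
  ac c d hc hcd hd := ((hψ.ac c d hc hcd hd).const_smul k).add (hφ.ac c d hc hcd hd)
  ac_quasiDeriv := by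
    have : ACLoc (k • quasiDeriv a ψ + quasiDeriv a φ) α β := fun c d hc hcd hd =>
      ((hψ.ac_quasiDeriv c d hc hcd hd).const_smul k).add (hφ.ac_quasiDeriv c d hc hcd hd)
    exact this.congr fun x hx => quasiDeriv_lin hP hψ hφ k hx
  memLp := (hψ.memLp.const_smul k).add hφ.memLp
  memLp_diffExpr := by
    refine ((hψ.memLp_diffExpr.const_smul k).add hφ.memLp_diffExpr).ae_eq ?_
    rw [EventuallyEq, ae_restrict_iff' measurableSet_Ioo]
    filter_upwards [diffExpr_lin hP hψ hφ k] with x hx hxI using (hx hxI).symm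

theorem IsMaxFun.lin {a : Fin 4 → ℝ} (ha : StrictMono a) {ψ φ : ℝ → ℂ} (hψ : IsMaxFun a ψ)
    (hφ : IsMaxFun a φ) (k : ℂ) : IsMaxFun a (k • ψ + φ) :=
  ⟨hψ.left.lin (fun _ => P_ne_zero_left ha) hφ.left k,
    hψ.right.lin (fun _ => P_ne_zero_right ha) hφ.right k⟩

theorem IsMaxFun.differentiableAt {a : Fin 4 → ℝ} (ha : StrictMono a) {ψ : ℝ → ℂ}
    (hψ : IsMaxFun a ψ) {x : ℝ} (hx : x ∈ Ioo (a 1) (a 2) ∪ Ioo (a 2) (a 3)) :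
    DifferentiableAt ℝ ψ x :=
  hx.elim (hψ.left.differentiableAt fun _ => P_ne_zero_left ha)
    (hψ.right.differentiableAt fun _ => P_ne_zero_right ha)

theorem isMaxFun_zero (a : Fin 4 → ℝ) : IsMaxFun a 0 := by
  have hq : quasiDeriv a 0 = 0 := by
    funext x; simp [quasiDeriv]
  have hd : diffExpr a 0 = 0 := by
    funext x; simp [diffExpr, hq]
  have h0 : ∀ α β, ACLoc 0 α β := fun α β c d _ _ _ =>
    ContDiffOn.absolutelyContinuousOnInterval contDiff_const.contDiffOn
  have : ∀ α β, IsMaxFunOn a α β 0 := fun α β =>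
    ⟨h0 α β, by rw [hq]; exact h0 α β, MemLp.zero, by rw [hd]; exact MemLp.zero⟩
  exact ⟨this _ _, this _ _⟩

theorem IsMinFun.lin {a : Fin 4 → ℝ} (ha : StrictMono a) {ψ φ : ℝ → ℂ} (hψ : IsMinFun a ψ)
    (hφ : IsMinFun a φ) (k : ℂ) : IsMinFun a (k • ψ + φ) := by
  have key : ∀ s : Set ℝ, closure (Function.support (k • ψ + φ) ∩ s) ⊆
      closure (Function.support ψ ∩ s) ∪ closure (Function.support φ ∩ s) := by
    intro s
    rw [← closure_union, ← union_inter_distrib_right]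
    refine closure_mono (inter_subset_inter_left _ ?_)
    exact (Function.support_add _ _).trans
      (union_subset_union_left _ (Function.support_const_smul_subset k ψ))
  exact ⟨hψ.max.lin ha hφ.max k, (key _).trans (union_subset hψ.supp_left hφ.supp_left),
    (key _).trans (union_subset hψ.supp_right hφ.supp_right)⟩

theorem isMinFun_zero (a : Fin 4 → ℝ) : IsMinFun a 0 :=
  ⟨isMaxFun_zero a, by simp, by simp⟩

theorem bracket_lin {a : Fin 4 → ℝ} (ha : StrictMono a) {ψ φ : ℝ → ℂ} (hψ : IsMaxFun a ψ)
    (hφ : IsMaxFun a φ) (k : ℂ) (w : ℝ → ℂ) {x : ℝ}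
    (hx : x ∈ Ioo (a 1) (a 2) ∪ Ioo (a 2) (a 3)) :
    k * bracket a ψ w x + bracket a φ w x = bracket a (k • ψ + φ) w x := by
  have h1 := hψ.differentiableAt ha hx
  have h2 := hφ.differentiableAt ha hx
  simp only [bracket, Pi.add_apply, Pi.smul_apply, smul_eq_mul]
  rw [deriv_add (h1.const_smul k) h2, deriv_const_smul _ h1, smul_eq_mul]
  ring

theorem tendsto_bracket_lin {a : Fin 4 → ℝ} (ha : StrictMono a) {ψ φ : ℝ → ℂ}
    (hψ : IsMaxFun a ψ) (hφ : IsMaxFun a φ) (k : ℂ) (w : ℝ → ℂ) {F : Filter ℝ}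
    (hF : Ioo (a 1) (a 2) ∪ Ioo (a 2) (a 3) ∈ F) {l m : ℂ}
    (h1 : Tendsto (bracket a ψ w) F (𝓝 l)) (h2 : Tendsto (bracket a φ w) F (𝓝 m)) :
    Tendsto (bracket a (k • ψ + φ) w) F (𝓝 (k * l + m)) := by
  refine ((h1.const_mul k).add h2).congr' ?_
  filter_upwards [hF] with x hx using bracket_lin ha hψ hφ k w hx

theorem IsSFun.lin {a : Fin 4 → ℝ} (ha : StrictMono a) {ψ φ : ℝ → ℂ} (hψ : IsSFun a ψ)
    (hφ : IsSFun a φ) (k : ℂ) : IsSFun a (k • ψ + φ) := by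
  have h12 : a 1 < a 2 := ha (by decide)
  have h23 : a 2 < a 3 := ha (by decide)
  have m1 : Ioo (a 1) (a 2) ∪ Ioo (a 2) (a 3) ∈ 𝓝[>] (a 1) :=
    mem_of_superset (Ioo_mem_nhdsGT h12) subset_union_left
  have m2 : Ioo (a 1) (a 2) ∪ Ioo (a 2) (a 3) ∈ 𝓝[<] (a 2) :=
    mem_of_superset (Ioo_mem_nhdsLT h12) subset_union_left
  have m3 : Ioo (a 1) (a 2) ∪ Ioo (a 2) (a 3) ∈ 𝓝[>] (a 2) :=
    mem_of_superset (Ioo_mem_nhdsGT h23) subset_union_right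
  have m4 : Ioo (a 1) (a 2) ∪ Ioo (a 2) (a 3) ∈ 𝓝[<] (a 3) :=
    mem_of_superset (Ioo_mem_nhdsLT h23) subset_union_right
  obtain ⟨l, hl, hl'⟩ := hψ.trans_u
  obtain ⟨m, hm, hm'⟩ := hφ.trans_u
  obtain ⟨l₂, hl₂, hl₂'⟩ := hψ.trans_v
  obtain ⟨m₂, hm₂, hm₂'⟩ := hφ.trans_v
  refine ⟨hψ.max.lin ha hφ.max k, ?_, ?_, ⟨k * l + m, ?_, ?_⟩, ⟨k * l₂ + m₂, ?_, ?_⟩⟩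
  · simpa using tendsto_bracket_lin ha hψ.max hφ.max k u m1 hψ.bc_left hφ.bc_left
  · simpa using tendsto_bracket_lin ha hψ.max hφ.max k u m4 hψ.bc_right hφ.bc_right
  · exact tendsto_bracket_lin ha hψ.max hφ.max k u m2 hl hm
  · exact tendsto_bracket_lin ha hψ.max hφ.max k u m3 hl' hm'
  · exact tendsto_bracket_lin ha hψ.max hφ.max k (v a) m2 hl₂ hm₂
  · exact tendsto_bracket_lin ha hψ.max hφ.max k (v a) m3 hl₂' hm₂'

theorem isSFun_zero (a : Fin 4 → ℝ) : IsSFun a 0 := by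
  have h : ∀ w, bracket a 0 w = fun _ => 0 := fun w => by
    funext x; simp [bracket]
  refine ⟨isMaxFun_zero a, ?_, ?_, ⟨0, ?_, ?_⟩, ⟨0, ?_, ?_⟩⟩ <;>
  · rw [h]; exact tendsto_const_nhds

/-! ### The domains and the operators in `L²(a₂, a₄)` -/

/-- The subspace of `L²(a₂, a₄)` of the classes of the functions with a property `p` that is
stable under linear combinations. -/
def classes (a : Fin 4 → ℝ) (p : (ℝ → ℂ) → Prop) (h0 : p 0)
    (hlin : ∀ ψ φ, p ψ → p φ → ∀ k : ℂ, p (k • ψ + φ)) : Submodule ℂ (H a) where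
  carrier := {f | ∃ ψ, p ψ ∧ f =ᵐ[mu a] ψ}
  zero_mem' := ⟨0, h0, Lp.coeFn_zero ℂ 2 (mu a)⟩
  add_mem' := by
    rintro f g ⟨ψ, hψ, hf⟩ ⟨φ, hφ, hg⟩
    refine ⟨(1 : ℂ) • ψ + φ, hlin ψ φ hψ hφ 1, ?_⟩
    filter_upwards [Lp.coeFn_add f g, hf, hg] with x h1 h2 h3
    rw [h1, one_smul, Pi.add_apply, Pi.add_apply, h2, h3]
  smul_mem' := by
    rintro k f ⟨ψ, hψ, hf⟩
    refine ⟨k • ψ + 0, hlin ψ 0 hψ h0 k, ?_⟩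
    filter_upwards [Lp.coeFn_smul k f, hf] with x h1 h2
    simp [h1, h2]

/-- `D_max` as a subspace of `L²(a₂, a₄)`. -/
def maxDomain (a : Fin 4 → ℝ) (ha : StrictMono a) : Submodule ℂ (H a) :=
  classes a (IsMaxFun a) (isMaxFun_zero a) fun _ _ h1 h2 k => h1.lin ha h2 k

/-- `D_min` as a subspace of `L²(a₂, a₄)`. -/
def minDomain (a : Fin 4 → ℝ) (ha : StrictMono a) : Submodule ℂ (H a) :=
  classes a (IsMinFun a) (isMinFun_zero a) fun _ _ h1 h2 k => h1.lin ha h2 k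

/-- `D(L_S)` as a subspace of `L²(a₂, a₄)`. -/
def sDomain (a : Fin 4 → ℝ) (ha : StrictMono a) : Submodule ℂ (H a) :=
  classes a (IsSFun a) (isSFun_zero a) fun _ _ h1 h2 k => h1.lin ha h2 k

theorem ae_mem_intervals (a : Fin 4 → ℝ) :
    ∀ᵐ x ∂(mu a), x ∈ Ioo (a 1) (a 2) ∪ Ioo (a 2) (a 3) := by
  rw [ae_restrict_iff' measurableSet_Ioo]
  filter_upwards [Measure.ae_ne volume (a 2)] with x hx hxI
  rcases lt_or_gt_of_ne hx with h | h
  · exact Or.inl ⟨hxI.1, h⟩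
  · exact Or.inr ⟨h, hxI.2⟩

/-- `L ψ ∈ L²(a₂, a₄)` for `ψ` in the maximal domain. -/
theorem IsMaxFun.memLp_diffExpr {a : Fin 4 → ℝ} {ψ : ℝ → ℂ} (hψ : IsMaxFun a ψ) :
    MemLp (diffExpr a ψ) 2 (mu a) := by
  have hm : mu a = volume.restrict (Ioo (a 1) (a 3) ∩ (Ioo (a 1) (a 2) ∪ Ioo (a 2) (a 3))) := by
    rw [inter_comm, ← Measure.restrict_restrict (measurableSet_Ioo.union measurableSet_Ioo)]
    exact (Measure.restrict_eq_self_of_ae_mem (ae_mem_intervals a)).symm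
  have hU : MemLp (diffExpr a ψ) 2
      (volume.restrict (Ioo (a 1) (a 2) ∪ Ioo (a 2) (a 3))) := by
    have hs : AEStronglyMeasurable (diffExpr a ψ)
        (volume.restrict (Ioo (a 1) (a 2) ∪ Ioo (a 2) (a 3))) :=
      aestronglyMeasurable_union_iff.2 ⟨hψ.left.memLp_diffExpr.1, hψ.right.memLp_diffExpr.1⟩
    rw [memLp_two_iff_integrable_sq_norm hs]
    exact IntegrableOn.union
      ((memLp_two_iff_integrable_sq_norm hψ.left.memLp_diffExpr.1).1 hψ.left.memLp_diffExpr)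
      ((memLp_two_iff_integrable_sq_norm hψ.right.memLp_diffExpr.1).1 hψ.right.memLp_diffExpr)
  rw [hm]
  exact hU.mono_measure (Measure.restrict_mono inter_subset_right le_rfl)

theorem ACLoc.eqOn_of_ae {f g : ℝ → ℂ} {α β : ℝ} (hf : ACLoc f α β) (hg : ACLoc g α β)
    (h : ∀ᵐ x ∂(volume.restrict (Ioo α β)), f x = g x) : ∀ x ∈ Ioo α β, f x = g x :=
  Measure.eqOn_open_of_ae_eq h isOpen_Ioo hf.continuousOn hg.continuousOn

/-- `L ψ` depends only on the class of `ψ`. -/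
theorem diffExpr_ae_congr {a : Fin 4 → ℝ} (ha : StrictMono a) {ψ φ : ℝ → ℂ}
    (hψ : IsMaxFun a ψ) (hφ : IsMaxFun a φ) (h : ψ =ᵐ[mu a] φ) :
    diffExpr a ψ =ᵐ[mu a] diffExpr a φ := by
  have h12 : a 1 < a 2 := ha (by decide)
  have h23 : a 2 < a 3 := ha (by decide)
  have e1 := hψ.left.ac.eqOn_of_ae hφ.left.ac
    (ae_restrict_of_ae_restrict_of_subset (Ioo_subset_Ioo_right h23.le) h)
  have e2 := hψ.right.ac.eqOn_of_ae hφ.right.ac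
    (ae_restrict_of_ae_restrict_of_subset (Ioo_subset_Ioo_left h12.le) h)
  filter_upwards [ae_mem_intervals a] with x hx
  exact hx.elim (diffExpr_congr e1) (diffExpr_congr e2)

theorem diffExpr_ae_lin {a : Fin 4 → ℝ} (ha : StrictMono a) {ψ φ : ℝ → ℂ}
    (hψ : IsMaxFun a ψ) (hφ : IsMaxFun a φ) (k : ℂ) :
    diffExpr a (k • ψ + φ) =ᵐ[mu a] k • diffExpr a ψ + diffExpr a φ := by
  filter_upwards [ae_mem_intervals a,
    ae_restrict_of_ae (diffExpr_lin (fun _ => P_ne_zero_left ha) hψ.left hφ.left k),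
    ae_restrict_of_ae (diffExpr_lin (fun _ => P_ne_zero_right ha) hψ.right hφ.right k)]
    with x hx h1 h2
  exact hx.elim h1 h2

/-- The value at `f` of the maximal operator: the class of `L ψ`, where `ψ` is a representative
of `f` that is a function of the maximal domain. -/
noncomputable def maxVal {a : Fin 4 → ℝ} {ha : StrictMono a} (f : maxDomain a ha) : H a :=
  (f.2.choose_spec.1.memLp_diffExpr).toLp (diffExpr a f.2.choose)

theorem maxVal_ae {a : Fin 4 → ℝ} {ha : StrictMono a} (f : maxDomain a ha) {ψ : ℝ → ℂ}
    (hψ : IsMaxFun a ψ) (h : (f : H a) =ᵐ[mu a] ψ) : maxVal f =ᵐ[mu a] diffExpr a ψ :=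
  (MemLp.coeFn_toLp _).trans
    (diffExpr_ae_congr ha f.2.choose_spec.1 hψ (f.2.choose_spec.2.symm.trans h))

/-- The maximal operator `L_max`. -/
noncomputable def maxOp (a : Fin 4 → ℝ) (ha : StrictMono a) : H a →ₗ.[ℂ] H a where
  domain := maxDomain a ha
  toFun :=
    { toFun := maxVal
      map_add' := by
        intro f g
        obtain ⟨ψ, hψ, hf⟩ := f.2
        obtain ⟨φ, hφ, hg⟩ := g.2
        have hfg : ((f + g : maxDomain a ha) : H a) =ᵐ[mu a] (1 : ℂ) • ψ + φ := by
          filter_upwards [Lp.coeFn_add (f : H a) (g : H a), hf, hg] with x h1 h2 h3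
          rw [Submodule.coe_add, h1, one_smul, Pi.add_apply, Pi.add_apply, h2, h3]
        refine Lp.ext ?_
        filter_upwards [maxVal_ae f hψ hf, maxVal_ae g hφ hg,
          maxVal_ae (f + g) (hψ.lin ha hφ 1) hfg, diffExpr_ae_lin ha hψ hφ 1,
          Lp.coeFn_add (maxVal f) (maxVal g)] with x h1 h2 h3 h4 h5
        rw [h3, h4, h5, one_smul, Pi.add_apply, Pi.add_apply, h1, h2]
      map_smul' := by
        intro k f
        obtain ⟨ψ, hψ, hf⟩ := f.2
        have hkf : ((k • f : maxDomain a ha) : H a) =ᵐ[mu a] k • ψ + 0 := by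
          filter_upwards [Lp.coeFn_smul k (f : H a), hf] with x h1 h2
          simp [h1, h2]
        have hd : diffExpr a 0 = 0 := by
          funext x
          have : quasiDeriv a 0 = 0 := by
            funext x; simp [quasiDeriv]
          simp [diffExpr, this]
        refine Lp.ext ?_
        filter_upwards [maxVal_ae f hψ hf,
          maxVal_ae (k • f) (hψ.lin ha (isMaxFun_zero a) k) hkf,
          diffExpr_ae_lin ha hψ (isMaxFun_zero a) k,
          Lp.coeFn_smul k (maxVal f)] with x h1 h3 h4 h5
        rw [h3, h4, RingHom.id_apply, h5]
        simp [h1, hd] }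

/-- The minimal operator `L_min`: the restriction of `L_max` to `D_min ⊆ D_max`. -/
noncomputable def minOp (a : Fin 4 → ℝ) (ha : StrictMono a) : H a →ₗ.[ℂ] H a :=
  (maxOp a ha).domRestrict (minDomain a ha)

/-- The operator `L_S`: the restriction of `L_max` to `D(L_S) ⊆ D_max`. -/
noncomputable def opS (a : Fin 4 → ℝ) (ha : StrictMono a) : H a →ₗ.[ℂ] H a :=
  (maxOp a ha).domRestrict (sDomain a ha)

theorem minOp_domain (a : Fin 4 → ℝ) (ha : StrictMono a) :
    (minOp a ha).domain = minDomain a ha :=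
  inf_eq_left.2 fun _ ⟨ψ, hψ, h⟩ => ⟨ψ, hψ.max, h⟩

theorem opS_domain (a : Fin 4 → ℝ) (ha : StrictMono a) :
    (opS a ha).domain = sDomain a ha :=
  inf_eq_left.2 fun _ ⟨ψ, hψ, h⟩ => ⟨ψ, hψ.max, h⟩

end TwoIntervalSL

namespace TwoIntervalSL

/-! ### Absolutely continuous complex-valued functions -/

/-! The coefficients of `v` are the residues of `1/P`, so `P v' = 1` away from the points `a i`, and
`1`, `v` solve `(P ψ')' = 0`. Hence `[ψ, u] = -P ψ'` and `[ψ, v] = ψ - v P ψ'` (`bracket_u`,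
`bracket_v`), with derivatives `-g` and `-v g` where `g = (P ψ')'`. Since `g` and `v` are in `L²`,
both derivatives are integrable on all of `(a₂, a₄)`.

The conditions defining `D(L_S)` therefore glue these two functions across `a₃` into single
primitives: `P ψ' = ∫ g` from `a₂`, the condition at `a₄` becomes `∫ g = 0`, and `ψ = c + K g` with
a free constant `c` and `K g = v ∫ g - ∫ v g` (`IsSFun.eq_solve`; the converse is `isSFun_solve`).
As `L ψ = g + Q ψ` with `Q` multiplication by the bounded real function `2 (x - σ)²`, the graph of
`L_S` is the set of pairs `(c + K g, g + Q (c + K g))` with `g ⊥ 1` (`graph_opS`).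

On the complement of `1`, `K` is symmetric: the difference of the two pairings is a boundary term
that vanishes because the integrals do (`integral_mul_solve`). An operator with such a graph is
densely defined and self-adjoint by Hilbert space algebra alone
(`dense_and_isSelfAdjoint_of_graph`).

For functions of the minimal domain all the brackets vanish near the endpoints, so `L_min ⊆ L_S`.
Closedness of the self-adjoint `L_S` gives the same for the closure. -/

theorem _root_.AbsolutelyContinuousOnInterval.ofReal {f : ℝ → ℝ} {a b : ℝ}
    (hf : AbsolutelyContinuousOnInterval f a b) :
    AbsolutelyContinuousOnInterval (fun x => (f x : ℂ)) a b := by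
  have h1 : AbsolutelyContinuousOnInterval (fun _ => (1 : ℂ)) a b :=
    ContDiffOn.absolutelyContinuousOnInterval contDiff_const.contDiffOn
  simpa using hf.fun_smul h1

theorem ac_primitive {f : ℝ → ℂ} {a b c : ℝ} (h : IntervalIntegrable f volume a b)
    (hc : c ∈ uIcc a b) : AbsolutelyContinuousOnInterval (fun x => ∫ t in c..x, f t) a b := by
  have hre : IntervalIntegrable (fun x => (f x).re) volume a b := ⟨h.1.re, h.2.re⟩
  have him : IntervalIntegrable (fun x => (f x).im) volume a b := ⟨h.1.im, h.2.im⟩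
  have h1 := (hre.absolutelyContinuousOnInterval_intervalIntegral hc).ofReal
  have h2 := ((him.absolutelyContinuousOnInterval_intervalIntegral hc).ofReal).const_smul Complex.I
  have h3 := h1.add h2
  rw [absolutelyContinuousOnInterval_iff] at h3 ⊢
  intro ε hε
  obtain ⟨δ, hδ, H⟩ := h3 ε hε
  refine ⟨δ, hδ, fun E hE hlt => ?_⟩
  -- The complex primitive splits into its real and imaginary parts only where `f` is known to be
  -- integrable, so absolute continuity is transferred through its ε-δ form, which sees only points
  -- of `uIcc a b`.
  have key : ∀ y ∈ uIcc a b, ∫ t in c..y, f t =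
      ((fun x => ((∫ t in c..x, (f t).re : ℝ) : ℂ)) +
        fun x => Complex.I • ((∫ t in c..x, (f t).im : ℝ) : ℂ)) y := by
    intro y hy
    have hcy : IntervalIntegrable f volume c y := h.mono_set (uIcc_subset_uIcc hc hy)
    have e : ∀ t, f t = ((f t).re : ℂ) + Complex.I * ((f t).im : ℂ) := fun t => by
      rw [mul_comm, Complex.re_add_im]
    calc ∫ t in c..y, f t = ∫ t in c..y, (((f t).re : ℂ) + Complex.I * ((f t).im : ℂ)) :=
          intervalIntegral.integral_congr fun t _ => e t
      _ = _ := by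
        have i1 : IntervalIntegrable (fun t => ((f t).re : ℂ)) volume c y :=
          ⟨hcy.1.re.ofReal, hcy.2.re.ofReal⟩
        have i2 : IntervalIntegrable (fun t => ((f t).im : ℂ)) volume c y :=
          ⟨hcy.1.im.ofReal, hcy.2.im.ofReal⟩
        rw [intervalIntegral.integral_add i1 (i2.const_mul _),
          intervalIntegral.integral_const_mul, intervalIntegral.integral_ofReal,
          intervalIntegral.integral_ofReal]
        rfl
  have := H E hE hlt
  rwa [Finset.sum_congr rfl fun i hi => by
    rw [key _ (hE.1 i hi).1, key _ (hE.1 i hi).2]]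

/-- Subtracting the primitive of `f'` leaves an absolutely continuous function with derivative zero
almost everywhere, hence a constant. -/
theorem integral_eq_sub_of_ac {f f' : ℝ → ℂ} {a b : ℝ}
    (hf : AbsolutelyContinuousOnInterval f a b) (hi : IntervalIntegrable f' volume a b)
    (hd : ∀ᵐ x, x ∈ uIcc a b → HasDerivAt f (f' x) x) :
    ∫ x in a..b, f' x = f b - f a := by
  obtain ⟨C, hC⟩ := (hf.sub (ac_primitive hi left_mem_uIcc)).const_of_ae_hasDerivAt_zero (by
    filter_upwards [hd, hi.ae_hasDerivAt_integral] with x h1 h2 hx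
    simpa using (h1 hx).sub (h2 hx a left_mem_uIcc))
  have h1 := hC a left_mem_uIcc
  have h2 := hC b right_mem_uIcc
  simp only [Pi.sub_apply, intervalIntegral.integral_same, sub_zero] at h1 h2
  rw [h1, ← h2]; ring

/-- By the fundamental theorem `f` is locally a constant plus a primitive of `h`, and continuity of
`h` makes that primitive differentiable at every point. -/
theorem ACLoc.hasDerivAt_of_ae {f h : ℝ → ℂ} {α β : ℝ} (hf : ACLoc f α β)
    (hh : ContinuousOn h (Ioo α β)) (hd : ∀ᵐ x, x ∈ Ioo α β → HasDerivAt f (h x) x) {x : ℝ}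
    (hx : x ∈ Ioo α β) : HasDerivAt f (h x) x := by
  obtain ⟨c, hc, hcx⟩ := exists_between hx.1
  have hI : ∀ y ∈ Ioo α β, uIcc c y ⊆ Ioo α β := fun y hy =>
    ordConnected_Ioo.uIcc_subset ⟨hc, hcx.trans hx.2⟩ hy
  have hi : ∀ y ∈ Ioo α β, IntervalIntegrable h volume c y := fun y hy =>
    (hh.mono (hI y hy)).intervalIntegrable
  have hF : HasDerivAt (fun z => f c + ∫ t in c..z, h t) (h x) x :=
    (intervalIntegral.integral_hasDerivAt_right (hi x hx)
      (hh.stronglyMeasurableAtFilter isOpen_Ioo x hx)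
      (hh.continuousAt (Ioo_mem_nhds hx.1 hx.2))).const_add _
  refine hF.congr_of_eventuallyEq ?_
  filter_upwards [Ioo_mem_nhds hcx hx.2] with y hy
  have hy' : y ∈ Ioo α β := ⟨hc.trans hy.1, hy.2⟩
  rw [integral_eq_sub_of_ac (hf c y hc hy.1.le hy.2) (hi y hy') (by
    filter_upwards [hd] with z hz hzI using hz (hI y hy' hzI))]
  ring

theorem ACLoc.of_ac {f : ℝ → ℂ} {α β a b : ℝ} (hf : AbsolutelyContinuousOnInterval f a b)
    (h1 : a ≤ α) (h2 : β ≤ b) : ACLoc f α β := fun c d hc hcd hd => hf.mono (by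
  rw [uIcc_of_le hcd, uIcc_of_le (by linarith)]
  exact Icc_subset_Icc (by linarith) (by linarith))

theorem ACLoc.add {f g : ℝ → ℂ} {α β : ℝ} (hf : ACLoc f α β) (hg : ACLoc g α β) :
    ACLoc (fun x => f x + g x) α β := fun c d h1 h2 h3 => (hf c d h1 h2 h3).add (hg c d h1 h2 h3)

theorem ACLoc.sub {f g : ℝ → ℂ} {α β : ℝ} (hf : ACLoc f α β) (hg : ACLoc g α β) :
    ACLoc (fun x => f x - g x) α β := fun c d h1 h2 h3 => (hf c d h1 h2 h3).sub (hg c d h1 h2 h3)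

theorem ACLoc.mul {f g : ℝ → ℂ} {α β : ℝ} (hf : ACLoc f α β) (hg : ACLoc g α β) :
    ACLoc (fun x => f x * g x) α β := fun c d h1 h2 h3 => (hf c d h1 h2 h3).smul (hg c d h1 h2 h3)

theorem aCLoc_const (k : ℂ) (α β : ℝ) : ACLoc (fun _ => k) α β := fun _ _ _ _ _ =>
  ContDiffOn.absolutelyContinuousOnInterval contDiff_const.contDiffOn

theorem ACLoc.of_hasDerivAt {f f' : ℝ → ℂ} {α β : ℝ}
    (hf : ∀ x ∈ Ioo α β, HasDerivAt f (f' x) x) (hc : ContinuousOn f' (Ioo α β)) :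
    ACLoc f α β := by
  have h : ContDiffOn ℝ 1 f (Ioo α β) := by
    rw [show (1 : WithTop ℕ∞) = 0 + 1 from (zero_add 1).symm,
      contDiffOn_succ_iff_deriv_of_isOpen isOpen_Ioo]
    refine ⟨fun y hy => (hf y hy).differentiableAt.differentiableWithinAt, by simp, ?_⟩
    rw [contDiffOn_zero]
    exact hc.congr fun y hy => (hf y hy).deriv
  intro c d h1 h2 h3
  refine (h.mono ?_).absolutelyContinuousOnInterval
  rw [uIcc_of_le h2]
  exact fun y hy => ⟨h1.trans_le hy.1, hy.2.trans_lt h3⟩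

/-- A primitive with a prescribed right limit. -/
theorem ACLoc.eq_add_integral_of_tendsto_right {f f' : ℝ → ℂ} {α β : ℝ} {l : ℂ}
    (hf : ACLoc f α β) (hi : IntervalIntegrable f' volume α β)
    (hd : ∀ᵐ x, x ∈ Ioo α β → HasDerivAt f (f' x) x) (hl : Tendsto f (𝓝[>] α) (𝓝 l)) {x : ℝ}
    (hx : x ∈ Ioo α β) : f x = l + ∫ t in α..x, f' t := by
  have hαβ : α < β := hx.1.trans hx.2
  have hsub : ∀ y ∈ Ioo α β, ∀ z ∈ Ioo α β, IntervalIntegrable f' volume y z := fun y hy z hz =>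
    hi.mono_set (by
      rw [uIcc_of_le hαβ.le]
      exact ordConnected_Icc.uIcc_subset (Ioo_subset_Icc_self hy) (Ioo_subset_Icc_self hz))
  have hxα : IntervalIntegrable f' volume α x := hi.mono_set (by
    rw [uIcc_of_le hαβ.le, uIcc_of_le hx.1.le]; exact Icc_subset_Icc_right hx.2.le)
  have hcont := intervalIntegral.continuousOn_primitive_interval' hi left_mem_uIcc
  rw [uIcc_of_le hαβ.le] at hcont
  have h0 : Tendsto (fun y => ∫ t in α..y, f' t) (𝓝[>] α) (𝓝 0) := by
    have := (hcont α (left_mem_Icc.2 hαβ.le)).mono_left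
      (nhdsWithin_le_of_mem (mem_of_superset (Ioo_mem_nhdsGT hαβ) Ioo_subset_Icc_self))
    simpa using this
  have h1 : Tendsto (fun y => f y + (∫ t in α..x, f' t) - ∫ t in α..y, f' t) (𝓝[>] α)
      (𝓝 (l + (∫ t in α..x, f' t) - 0)) := (hl.add_const _).sub h0
  -- For `y` in `(α, x)` this expression is constantly `f x`, so its two limits as `y` tends to `α`
  -- must agree.
  have h2 : Tendsto (fun y => f y + (∫ t in α..x, f' t) - ∫ t in α..y, f' t) (𝓝[>] α)
      (𝓝 (f x)) := by
    refine tendsto_const_nhds.congr' ?_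
    filter_upwards [Ioo_mem_nhdsGT hx.1] with y hy
    have hy' : y ∈ Ioo α β := ⟨hy.1, hy.2.trans hx.2⟩
    have e1 := integral_eq_sub_of_ac (hf y x hy.1 hy.2.le hx.2) (hsub y hy' x hx) (by
      filter_upwards [hd] with z hz hzI
      exact hz (ordConnected_Ioo.uIcc_subset hy' hx hzI))
    have e2 := intervalIntegral.integral_interval_sub_left hxα
      (hxα.mono_set (by
        rw [uIcc_of_le hy.1.le, uIcc_of_le hx.1.le]; exact Icc_subset_Icc_right hy.2.le))
    rw [add_sub_assoc, e2, e1]; ring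
  have := tendsto_nhds_unique h2 h1
  rw [this, sub_zero]

/-- A primitive with a prescribed left limit. -/
theorem ACLoc.eq_sub_integral_of_tendsto_left {f f' : ℝ → ℂ} {α β : ℝ} {l : ℂ}
    (hf : ACLoc f α β) (hi : IntervalIntegrable f' volume α β)
    (hd : ∀ᵐ x, x ∈ Ioo α β → HasDerivAt f (f' x) x) (hl : Tendsto f (𝓝[<] β) (𝓝 l)) {x : ℝ}
    (hx : x ∈ Ioo α β) : f x = l - ∫ t in x..β, f' t := by
  have hαβ : α < β := hx.1.trans hx.2
  have hsub : ∀ y ∈ Ioo α β, ∀ z ∈ Ioo α β, IntervalIntegrable f' volume y z := fun y hy z hz =>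
    hi.mono_set (by
      rw [uIcc_of_le hαβ.le]
      exact ordConnected_Icc.uIcc_subset (Ioo_subset_Icc_self hy) (Ioo_subset_Icc_self hz))
  have hxβ : IntervalIntegrable f' volume x β := hi.mono_set (by
    rw [uIcc_of_le hαβ.le, uIcc_of_le hx.2.le]; exact Icc_subset_Icc_left hx.1.le)
  have hcont := intervalIntegral.continuousOn_primitive_interval' hxβ left_mem_uIcc
  rw [uIcc_of_le hx.2.le] at hcont
  have h0 : Tendsto (fun y => ∫ t in x..y, f' t) (𝓝[<] β) (𝓝 (∫ t in x..β, f' t)) :=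
    (hcont β (right_mem_Icc.2 hx.2.le)).mono_left
      (nhdsWithin_le_of_mem (mem_of_superset (Ioo_mem_nhdsLT hx.2) Ioo_subset_Icc_self))
  have h2 : Tendsto (fun y => f y - ∫ t in x..y, f' t) (𝓝[<] β) (𝓝 (f x)) := by
    refine tendsto_const_nhds.congr' ?_
    filter_upwards [Ioo_mem_nhdsLT hx.2] with y hy
    have hy' : y ∈ Ioo α β := ⟨hx.1.trans hy.1, hy.2⟩
    rw [integral_eq_sub_of_ac (hf x y hx.1 hy.1.le hy.2) (hsub x hx y hy') (by
      filter_upwards [hd] with z hz hzI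
      exact hz (ordConnected_Ioo.uIcc_subset hx hy' hzI))]
    ring
  exact tendsto_nhds_unique h2 (hl.sub h0)

/-! ### The functions `u` and `v` -/

theorem P_ne_zero {a : Fin 4 → ℝ} {x : ℝ} (hx : ∀ i, x ≠ a i) : P a x ≠ 0 :=
  Finset.prod_ne_zero_iff.2 fun i _ => sub_ne_zero.2 (hx i)

/-- The function `v`, with real values. -/
noncomputable def vRe (a : Fin 4 → ℝ) (y : ℝ) : ℝ :=
  ∑ i, (∏ j ∈ Finset.univ.erase i, 1 / (a i - a j)) * Real.log |y - a i|

theorem v_eq (a : Fin 4 → ℝ) (y : ℝ) : v a y = (vRe a y : ℂ) := rfl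

/-- This is what makes `v` an antiderivative of `1/P`. -/
theorem partial_fractions {a : Fin 4 → ℝ} (ha : StrictMono a) {x : ℝ} (hx : ∀ i, x ≠ a i) :
    ∑ i, (∏ j ∈ Finset.univ.erase i, 1 / (a i - a j)) * (x - a i)⁻¹ = (P a x)⁻¹ := by
  have n : ∀ i j, i ≠ j → a i - a j ≠ 0 := fun i j h => sub_ne_zero.2 (ha.injective.ne h)
  have n01 := n 0 1 (by decide)
  have n02 := n 0 2 (by decide)
  have n03 := n 0 3 (by decide)
  have n12 := n 1 2 (by decide)
  have n13 := n 1 3 (by decide)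
  have n23 := n 2 3 (by decide)
  have x0 := sub_ne_zero.2 (hx 0)
  have x1 := sub_ne_zero.2 (hx 1)
  have x2 := sub_ne_zero.2 (hx 2)
  have x3 := sub_ne_zero.2 (hx 3)
  have e0 : (Finset.univ.erase 0 : Finset (Fin 4)) = {1, 2, 3} := by decide
  have e1 : (Finset.univ.erase 1 : Finset (Fin 4)) = {0, 2, 3} := by decide
  have e2 : (Finset.univ.erase 2 : Finset (Fin 4)) = {0, 1, 3} := by decide
  have e3 : (Finset.univ.erase 3 : Finset (Fin 4)) = {0, 1, 2} := by decide
  have s : ∀ i j, a i - a j = -(a j - a i) := fun i j => by ring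
  rw [Fin.sum_univ_four, e0, e1, e2, e3]
  simp only [P, Fin.prod_univ_four]
  simp only [Finset.prod_insert, Finset.prod_singleton, Finset.mem_insert, Finset.mem_singleton,
    Fin.reduceEq, or_self, not_false_eq_true]
  -- All differences get the orientation of the nonvanishing facts `n01`, ..., `n23`.
  rw [s 1 0, s 2 0, s 3 0, s 2 1, s 3 1, s 3 2]
  field_simp
  ring

theorem hasDerivAt_vRe {a : Fin 4 → ℝ} (ha : StrictMono a) {x : ℝ} (hx : ∀ i, x ≠ a i) :
    HasDerivAt (vRe a) (P a x)⁻¹ x := by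
  rw [← partial_fractions ha hx]
  have : vRe a = fun y => ∑ i, (∏ j ∈ Finset.univ.erase i, 1 / (a i - a j)) *
      Real.log (y - a i) := by
    funext y; simp [vRe, Real.log_abs]
  rw [this]
  refine HasDerivAt.fun_sum fun i _ => ?_
  have h := ((hasDerivAt_id x).sub_const (a i)).log (sub_ne_zero.2 (hx i))
  simpa [one_div] using h.const_mul (∏ j ∈ Finset.univ.erase i, 1 / (a i - a j))

theorem hasDerivAt_v {a : Fin 4 → ℝ} (ha : StrictMono a) {x : ℝ} (hx : ∀ i, x ≠ a i) :
    HasDerivAt (v a) (P a x : ℂ)⁻¹ x := by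
  have h := (hasDerivAt_vRe ha hx).ofReal_comp
  rw [Complex.ofReal_inv] at h
  exact h

/-! ### Square integrability of the logarithmic singularities -/

/-- The exponent `1/4` makes the square grow only like `x ^ (-1/2)` at zero, which is integrable.
From `|log x| ≤ 4 (s + t)` and `(s + t)² ≤ 2 (s² + t²)` comes the constant `32`. -/
theorem log_sq_le {x : ℝ} (hx : 0 < x) :
    Real.log x ^ 2 ≤ 32 * (x ^ (1 / 2 : ℝ) + x ^ (-1 / 2 : ℝ)) := by
  have h1 := Real.log_le_rpow_div hx.le (ε := 1 / 4) (by norm_num)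
  have h2 := Real.log_le_rpow_div (inv_pos.2 hx).le (ε := 1 / 4) (by norm_num)
  rw [Real.log_inv, Real.inv_rpow hx.le, ← Real.rpow_neg hx.le] at h2
  have p1 := Real.rpow_nonneg hx.le (1 / 4)
  have p2 := Real.rpow_nonneg hx.le (-(1 / 4))
  have e1 : x ^ (1 / 2 : ℝ) = (x ^ (1 / 4 : ℝ)) ^ 2 := by
    rw [← Real.rpow_natCast, ← Real.rpow_mul hx.le]; norm_num
  have e2 : x ^ (-1 / 2 : ℝ) = (x ^ (-(1 / 4) : ℝ)) ^ 2 := by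
    rw [← Real.rpow_natCast, ← Real.rpow_mul hx.le]; norm_num
  rw [e1, e2]
  set s := x ^ (1 / 4 : ℝ)
  set t := x ^ (-(1 / 4) : ℝ)
  have h3 : |Real.log x| ≤ 4 * (s + t) := abs_le.2 ⟨by linarith, by linarith⟩
  have h4 := pow_le_pow_left₀ (abs_nonneg _) h3 2
  rw [sq_abs] at h4
  nlinarith [sq_nonneg (s - t)]

theorem intervalIntegrable_log_sq_of_nonneg {b : ℝ} (hb : 0 ≤ b) :
    IntervalIntegrable (fun x => Real.log x ^ 2) volume 0 b := by
  have h : IntervalIntegrable (fun x : ℝ => 32 * (x ^ (1 / 2 : ℝ) + x ^ (-1 / 2 : ℝ)))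
      volume 0 b :=
    ((intervalIntegral.intervalIntegrable_rpow' (by norm_num)).add
      (intervalIntegral.intervalIntegrable_rpow' (by norm_num))).const_mul 32
  refine h.mono_fun (by fun_prop) ?_
  rw [uIoc_of_le hb, EventuallyLE, ae_restrict_iff' measurableSet_Ioc]
  refine Eventually.of_forall fun x hx => ?_
  rw [Real.norm_of_nonneg (sq_nonneg _)]
  exact (log_sq_le hx.1).trans (le_abs_self _)

theorem intervalIntegrable_log_sq (b c : ℝ) :
    IntervalIntegrable (fun x => Real.log x ^ 2) volume b c := by
  have h : ∀ d : ℝ, IntervalIntegrable (fun x => Real.log x ^ 2) volume 0 d := by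
    intro d
    rcases le_total 0 d with hd | hd
    · exact intervalIntegrable_log_sq_of_nonneg hd
    · have := (intervalIntegrable_log_sq_of_nonneg (neg_nonneg.2 hd)).comp_sub_left 0
      simpa using this
  exact (h b).symm.trans (h c)

theorem memLp_log {α β : ℝ} (hαβ : α ≤ β) (c : ℝ) :
    MemLp (fun x => Real.log |x - c|) 2 (volume.restrict (Ioo α β)) := by
  have hm : Measurable fun x => Real.log |x - c| :=
    Real.measurable_log.comp (by fun_prop)
  rw [memLp_two_iff_integrable_sq hm.aestronglyMeasurable]
  have h := (intervalIntegrable_log_sq (α - c) (β - c)).comp_sub_right c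
  simp only [sub_add_cancel] at h
  have h' := (intervalIntegrable_iff_integrableOn_Ioo_of_le hαβ).1 h
  simpa only [Real.log_abs, IntegrableOn] using h'

theorem memLp_v (a : Fin 4 → ℝ) {α β : ℝ} (hαβ : α ≤ β) :
    MemLp (v a) 2 (volume.restrict (Ioo α β)) :=
  (memLp_finsetSum Finset.univ fun i _ => (memLp_log hαβ (a i)).const_mul
    (∏ j ∈ Finset.univ.erase i, 1 / (a i - a j))).ofReal

theorem memLp_potential_mul (a : Fin 4 → ℝ) {ψ : ℝ → ℂ} {α β : ℝ}
    (h : MemLp ψ 2 (volume.restrict (Ioo α β))) :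
    MemLp (fun x : ℝ => 2 * ((x : ℂ) - (sigma a : ℂ)) ^ 2 * ψ x) 2 (volume.restrict (Ioo α β)) := by
  have hc : Continuous fun x : ℝ => 2 * ((x : ℂ) - (sigma a : ℂ)) ^ 2 := by fun_prop
  obtain ⟨C, hC⟩ := (isCompact_Icc (a := α) (b := β)).exists_bound_of_continuousOn hc.continuousOn
  refine MemLp.of_le_mul (c := C) h (hc.aestronglyMeasurable.mul h.1) ?_
  rw [ae_restrict_iff' measurableSet_Ioo]
  refine Eventually.of_forall fun x hx => ?_
  rw [norm_mul]
  gcongr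
  exact hC x (Ioo_subset_Icc_self hx)

theorem ne_of_mem_left {a : Fin 4 → ℝ} (ha : StrictMono a) {x : ℝ} (hx : x ∈ Ioo (a 1) (a 2)) :
    ∀ i, x ≠ a i := fun i h => P_ne_zero_left ha hx (Finset.prod_eq_zero (Finset.mem_univ i)
  (sub_eq_zero.2 h))

theorem ne_of_mem_right {a : Fin 4 → ℝ} (ha : StrictMono a) {x : ℝ} (hx : x ∈ Ioo (a 2) (a 3)) :
    ∀ i, x ≠ a i := fun i h => P_ne_zero_right ha hx (Finset.prod_eq_zero (Finset.mem_univ i)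
  (sub_eq_zero.2 h))

theorem aCLoc_v {a : Fin 4 → ℝ} (ha : StrictMono a) {α β : ℝ}
    (hI : ∀ x ∈ Ioo α β, ∀ i, x ≠ a i) : ACLoc (v a) α β := by
  refine ACLoc.of_hasDerivAt (fun x hx => hasDerivAt_v ha (hI x hx)) (ContinuousOn.inv₀
    (Complex.continuous_ofReal.comp (continuous_P a)).continuousOn fun x hx => ?_)
  exact_mod_cast P_ne_zero (hI x hx)

/-- With `P ψ'` constant only the potential term of `L ψ` survives, and it is bounded. This serves
`u` with `k = 0` and `v` with `k = 1`. -/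
theorem isMaxFunOn_of_quasiDeriv_const {a : Fin 4 → ℝ} {α β : ℝ} {ψ : ℝ → ℂ} (k : ℂ)
    (hac : ACLoc ψ α β) (hq : ∀ x ∈ Ioo α β, quasiDeriv a ψ x = k)
    (hL : MemLp ψ 2 (volume.restrict (Ioo α β))) : IsMaxFunOn a α β ψ := by
  refine ⟨hac, (aCLoc_const k α β).congr hq, hL, (memLp_potential_mul a hL).ae_eq ?_⟩
  rw [EventuallyEq, ae_restrict_iff' measurableSet_Ioo]
  refine Eventually.of_forall fun x hx => ?_
  have : quasiDeriv a ψ =ᶠ[𝓝 x] fun _ => k := by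
    filter_upwards [Ioo_mem_nhds hx.1 hx.2] with y hy using hq y hy
  simp [diffExpr, this.deriv_eq]

theorem quasiDeriv_v {a : Fin 4 → ℝ} (ha : StrictMono a) {x : ℝ} (hx : ∀ i, x ≠ a i) :
    quasiDeriv a (v a) x = 1 := by
  rw [quasiDeriv, (hasDerivAt_v ha hx).deriv, mul_inv_cancel₀]
  exact_mod_cast P_ne_zero hx

theorem isMaxFun_u (a : Fin 4 → ℝ) : IsMaxFun a u := by
  have h : ∀ α β, IsMaxFunOn a α β u := fun α β =>
    isMaxFunOn_of_quasiDeriv_const 0 (aCLoc_const 1 α β) (fun x _ => by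
      have : u = fun _ => (1 : ℂ) := rfl
      simp [quasiDeriv, this]) (memLp_const 1)
  exact ⟨h _ _, h _ _⟩

theorem isMaxFun_v {a : Fin 4 → ℝ} (ha : StrictMono a) : IsMaxFun a (v a) := by
  have h12 : a 1 < a 2 := ha (by decide)
  have h23 : a 2 < a 3 := ha (by decide)
  exact ⟨isMaxFunOn_of_quasiDeriv_const 1 (aCLoc_v ha fun x hx => ne_of_mem_left ha hx)
      (fun x hx => quasiDeriv_v ha (ne_of_mem_left ha hx)) (memLp_v a h12.le),
    isMaxFunOn_of_quasiDeriv_const 1 (aCLoc_v ha fun x hx => ne_of_mem_right ha hx)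
      (fun x hx => quasiDeriv_v ha (ne_of_mem_right ha hx)) (memLp_v a h23.le)⟩

/-! ### The solution operator of `(P ψ')' = g` -/

theorem endpoints_lt {a : Fin 4 → ℝ} (ha : StrictMono a) : a 1 < a 2 ∧ a 2 < a 3 ∧ a 1 < a 3 :=
  ⟨ha (by decide), ha (by decide), ha (by decide)⟩

/-- The function `v(x) ∫ g - ∫ v g`, the integrals being over `(a₂, x)`. -/
noncomputable def solve (a : Fin 4 → ℝ) (g : ℝ → ℂ) (x : ℝ) : ℂ :=
  v a x * (∫ t in (a 1)..x, g t) - ∫ t in (a 1)..x, v a t * g t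

theorem memLp_mu_v {a : Fin 4 → ℝ} (ha : StrictMono a) : MemLp (v a) 2 (mu a) :=
  memLp_v a (endpoints_lt ha).2.2.le

theorem intervalIntegrable_of_integrable_mu {a : Fin 4 → ℝ} (ha : StrictMono a) {g : ℝ → ℂ}
    (hg : Integrable g (mu a)) : IntervalIntegrable g volume (a 1) (a 3) :=
  (intervalIntegrable_iff_integrableOn_Ioo_of_le (endpoints_lt ha).2.2.le).2 hg

theorem intervalIntegrable_of_memLp {a : Fin 4 → ℝ} (ha : StrictMono a) {g : ℝ → ℂ}
    (hg : MemLp g 2 (mu a)) : IntervalIntegrable g volume (a 1) (a 3) :=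
  intervalIntegrable_of_integrable_mu ha (hg.integrable (by norm_num))

theorem intervalIntegrable_v_mul {a : Fin 4 → ℝ} (ha : StrictMono a) {g : ℝ → ℂ}
    (hg : MemLp g 2 (mu a)) : IntervalIntegrable (fun t => v a t * g t) volume (a 1) (a 3) :=
  intervalIntegrable_of_integrable_mu ha ((memLp_mu_v ha).integrable_mul hg)

theorem integral_mu {a : Fin 4 → ℝ} (ha : StrictMono a) (g : ℝ → ℂ) :
    ∫ t, g t ∂(mu a) = ∫ t in (a 1)..(a 3), g t := by
  rw [intervalIntegral.integral_of_le (endpoints_lt ha).2.2.le, integral_Ioc_eq_integral_Ioo]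

theorem memLp_two_bounded_mul {f k : ℝ → ℂ} {α β : ℝ} (hαβ : α ≤ β)
    (hf : MemLp f 2 (volume.restrict (Ioo α β))) (hk : ContinuousOn k (uIcc α β)) :
    MemLp (fun x => f x * k x) 2 (volume.restrict (Ioo α β)) := by
  rw [uIcc_of_le hαβ] at hk
  obtain ⟨C, hC⟩ := isCompact_Icc.exists_bound_of_continuousOn hk
  refine MemLp.of_le_mul (c := C) hf (hf.1.mul
    ((hk.mono Ioo_subset_Icc_self).aestronglyMeasurable measurableSet_Ioo)) ?_
  rw [ae_restrict_iff' measurableSet_Ioo]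
  refine Eventually.of_forall fun x hx => ?_
  rw [norm_mul, mul_comm]
  gcongr
  exact hC x (Ioo_subset_Icc_self hx)

theorem memLp_solve {a : Fin 4 → ℝ} (ha : StrictMono a) {g : ℝ → ℂ} (hg : MemLp g 2 (mu a)) :
    MemLp (solve a g) 2 (mu a) := by
  have hle := (endpoints_lt ha).2.2.le
  have h1 := intervalIntegral.continuousOn_primitive_interval'
    (intervalIntegrable_of_memLp ha hg) left_mem_uIcc
  have h2 := intervalIntegral.continuousOn_primitive_interval'
    (intervalIntegrable_v_mul ha hg) left_mem_uIcc
  refine (memLp_two_bounded_mul hle (memLp_mu_v ha) h1).sub ?_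
  simpa using memLp_two_bounded_mul hle (memLp_const (1 : ℂ)) h2

/-- Variation of parameters: in the derivative of `v ∫ g - ∫ v g` the terms `v g` cancel and `(∫ g)
/ P` remains. The product rule gives this almost everywhere, and continuity of the result upgrades
it to every point. -/
theorem solve_add_const_spec {a : Fin 4 → ℝ} (ha : StrictMono a) {g : ℝ → ℂ}
    (hg : MemLp g 2 (mu a)) (c : ℂ) {α β : ℝ} (hα : a 1 ≤ α) (hβ : β ≤ a 3)
    (hI : ∀ x ∈ Ioo α β, ∀ i, x ≠ a i) :
    ACLoc (fun x => c + solve a g x) α β ∧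
    (∀ x ∈ Ioo α β, quasiDeriv a (fun x => c + solve a g x) x = ∫ t in (a 1)..x, g t) ∧
    ACLoc (quasiDeriv a (fun x => c + solve a g x)) α β ∧
    ∀ᵐ x, x ∈ Ioo α β → diffExpr a (fun x => c + solve a g x) x =
      g x + 2 * ((x : ℂ) - (sigma a : ℂ)) ^ 2 * (c + solve a g x) := by
  have hle := (endpoints_lt ha).2.2.le
  have hsub : Ioo α β ⊆ uIcc (a 1) (a 3) := by
    rw [uIcc_of_le hle]; exact Ioo_subset_Icc_self.trans (Icc_subset_Icc hα hβ)
  have ig := intervalIntegrable_of_memLp ha hg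
  have iv := intervalIntegrable_v_mul ha hg
  have acG : ACLoc (fun x => ∫ t in (a 1)..x, g t) α β :=
    ACLoc.of_ac (ac_primitive ig left_mem_uIcc) hα hβ
  have acA : ACLoc (fun x => ∫ t in (a 1)..x, v a t * g t) α β :=
    ACLoc.of_ac (ac_primitive iv left_mem_uIcc) hα hβ
  have ac : ACLoc (fun x => c + solve a g x) α β :=
    (aCLoc_const c α β).add (((aCLoc_v ha hI).mul acG).sub acA)
  have hP : ∀ x ∈ Ioo α β, (P a x : ℂ) ≠ 0 := fun x hx => by
    exact_mod_cast P_ne_zero (hI x hx)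
  have hcP : ContinuousOn (fun x => (P a x : ℂ)⁻¹) (Ioo α β) :=
    ContinuousOn.inv₀ (Complex.continuous_ofReal.comp (continuous_P a)).continuousOn hP
  have hder : ∀ x ∈ Ioo α β, HasDerivAt (fun x => c + solve a g x)
      ((P a x : ℂ)⁻¹ * ∫ t in (a 1)..x, g t) x := fun x hx => by
    refine ac.hasDerivAt_of_ae (h := fun x => (P a x : ℂ)⁻¹ * ∫ t in (a 1)..x, g t)
      (hcP.mul acG.continuousOn) ?_ hx
    filter_upwards [ig.ae_hasDerivAt_integral, iv.ae_hasDerivAt_integral] with y h1 h2 hy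
    have := (((hasDerivAt_v ha (hI y hy)).mul (h1 (hsub hy) _ left_mem_uIcc)).sub
      (h2 (hsub hy) _ left_mem_uIcc)).const_add c
    rw [add_sub_cancel_right] at this
    exact this
  have hq : ∀ x ∈ Ioo α β, quasiDeriv a (fun x => c + solve a g x) x =
      ∫ t in (a 1)..x, g t := fun x hx => by
    rw [quasiDeriv, (hder x hx).deriv, mul_inv_cancel_left₀ (hP x hx)]
  refine ⟨ac, hq, acG.congr hq, ?_⟩
  filter_upwards [ig.ae_hasDerivAt_integral] with x h1 hx
  have hev : quasiDeriv a (fun x => c + solve a g x) =ᶠ[𝓝 x] fun x => ∫ t in (a 1)..x, g t := by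
    filter_upwards [Ioo_mem_nhds hx.1 hx.2] with y hy using hq y hy
  rw [diffExpr, hev.deriv_eq, (h1 (hsub hx) _ left_mem_uIcc).deriv]

/-! ### The boundary forms against `u` and `v` -/

theorem bracket_u (a : Fin 4 → ℝ) (f : ℝ → ℂ) (x : ℝ) :
    bracket a f u x = -quasiDeriv a f x := by
  simp [bracket, u, quasiDeriv]

theorem conj_v (a : Fin 4 → ℝ) (x : ℝ) : (starRingEnd ℂ) (v a x) = v a x := by
  rw [v_eq, Complex.conj_ofReal]

/-- Uses that `v` is real and `P v' = 1`. The combination removes the logarithmic part of `f` at an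
endpoint. -/
theorem bracket_v {a : Fin 4 → ℝ} (ha : StrictMono a) (f : ℝ → ℂ) {x : ℝ}
    (hx : ∀ i, x ≠ a i) : bracket a f (v a) x = f x - v a x * quasiDeriv a f x := by
  have h := quasiDeriv_v ha hx
  rw [quasiDeriv] at h
  simp only [bracket, conj_v, quasiDeriv]
  rw [mul_assoc, show deriv (fun y => v a y) x = deriv (v a) x from rfl, h]
  ring

theorem ae_mu_of_intervals {a : Fin 4 → ℝ} {p : ℝ → Prop}
    (h1 : ∀ᵐ x, x ∈ Ioo (a 1) (a 2) → p x) (h2 : ∀ᵐ x, x ∈ Ioo (a 2) (a 3) → p x) :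
    ∀ᵐ x ∂(mu a), p x := by
  filter_upwards [ae_mem_intervals a, ae_restrict_of_ae h1, ae_restrict_of_ae h2] with x hx e1 e2
  exact hx.elim e1 e2

theorem isMaxFun_solve {a : Fin 4 → ℝ} (ha : StrictMono a) {g : ℝ → ℂ}
    (hg : MemLp g 2 (mu a)) (c : ℂ) : IsMaxFun a (fun x => c + solve a g x) := by
  obtain ⟨h12, h23, h13⟩ := endpoints_lt ha
  have hL : MemLp (fun x => c + solve a g x) 2 (mu a) := (memLp_const c).add (memLp_solve ha hg)
  have key : ∀ α β, a 1 ≤ α → β ≤ a 3 → (∀ x ∈ Ioo α β, ∀ i, x ≠ a i) →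
      IsMaxFunOn a α β (fun x => c + solve a g x) := by
    intro α β hα hβ hI
    have hle : volume.restrict (Ioo α β) ≤ mu a :=
      Measure.restrict_mono (Ioo_subset_Ioo hα hβ) le_rfl
    obtain ⟨s1, -, s3, s4⟩ := solve_add_const_spec ha hg c hα hβ hI
    refine ⟨s1, s3, hL.mono_measure hle, ((hg.mono_measure hle).add
      (memLp_potential_mul a (hL.mono_measure hle))).ae_eq ?_⟩
    rw [EventuallyEq, ae_restrict_iff' measurableSet_Ioo]
    filter_upwards [s4] with x hx hxI using (hx hxI).symm
  exact ⟨key _ _ le_rfl h23.le fun x hx => ne_of_mem_left ha hx,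
    key _ _ h12.le le_rfl fun x hx => ne_of_mem_right ha hx⟩

theorem diffExpr_solve {a : Fin 4 → ℝ} (ha : StrictMono a) {g : ℝ → ℂ}
    (hg : MemLp g 2 (mu a)) (c : ℂ) : ∀ᵐ x ∂(mu a), diffExpr a (fun x => c + solve a g x) x =
      g x + 2 * ((x : ℂ) - (sigma a : ℂ)) ^ 2 * (c + solve a g x) := by
  obtain ⟨h12, h23, h13⟩ := endpoints_lt ha
  exact ae_mu_of_intervals
    (solve_add_const_spec ha hg c le_rfl h23.le fun x hx => ne_of_mem_left ha hx).2.2.2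
    (solve_add_const_spec ha hg c h12.le le_rfl fun x hx => ne_of_mem_right ha hx).2.2.2

/-- The brackets are `-∫ g` and `c - ∫ v g`, restrictions of functions continuous on the whole of
`[a₂, a₄]`, so transmission at `a₃` is automatic. The hypothesis `h0` is needed only for the
condition at `a₄`. -/
theorem isSFun_solve {a : Fin 4 → ℝ} (ha : StrictMono a) {g : ℝ → ℂ}
    (hg : MemLp g 2 (mu a)) (h0 : ∫ t in (a 1)..(a 3), g t = 0) (c : ℂ) :
    IsSFun a (fun x => c + solve a g x) := by
  obtain ⟨h12, h23, h13⟩ := endpoints_lt ha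
  have q1 := (solve_add_const_spec ha hg c le_rfl h23.le fun x hx => ne_of_mem_left ha hx).2.1
  have q2 := (solve_add_const_spec ha hg c h12.le le_rfl fun x hx => ne_of_mem_right ha hx).2.1
  have cG := intervalIntegral.continuousOn_primitive_interval'
    (intervalIntegrable_of_memLp ha hg) left_mem_uIcc
  have cA := intervalIntegral.continuousOn_primitive_interval'
    (intervalIntegrable_v_mul ha hg) left_mem_uIcc
  rw [uIcc_of_le h13.le] at cG cA
  have n1 : Ioo (a 1) (a 2) ∈ 𝓝[>] (a 1) := Ioo_mem_nhdsGT h12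
  have n2 : Ioo (a 1) (a 2) ∈ 𝓝[<] (a 2) := Ioo_mem_nhdsLT h12
  have n3 : Ioo (a 2) (a 3) ∈ 𝓝[>] (a 2) := Ioo_mem_nhdsGT h23
  have n4 : Ioo (a 2) (a 3) ∈ 𝓝[<] (a 3) := Ioo_mem_nhdsLT h23
  have s1 : Ioo (a 1) (a 2) ⊆ Icc (a 1) (a 3) :=
    Ioo_subset_Icc_self.trans (Icc_subset_Icc_right h23.le)
  have s2 : Ioo (a 2) (a 3) ⊆ Icc (a 1) (a 3) :=
    Ioo_subset_Icc_self.trans (Icc_subset_Icc_left h12.le)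
  have u1 : ∀ x ∈ Ioo (a 1) (a 2), -(∫ t in (a 1)..x, g t) =
      bracket a (fun x => c + solve a g x) u x := fun x hx => by rw [bracket_u, q1 x hx]
  have u2 : ∀ x ∈ Ioo (a 2) (a 3), -(∫ t in (a 1)..x, g t) =
      bracket a (fun x => c + solve a g x) u x := fun x hx => by rw [bracket_u, q2 x hx]
  have v1 : ∀ x ∈ Ioo (a 1) (a 2), c - (∫ t in (a 1)..x, v a t * g t) =
      bracket a (fun x => c + solve a g x) (v a) x := fun x hx => by
    rw [bracket_v ha _ (ne_of_mem_left ha hx), q1 x hx, solve]; ring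
  have v2 : ∀ x ∈ Ioo (a 2) (a 3), c - (∫ t in (a 1)..x, v a t * g t) =
      bracket a (fun x => c + solve a g x) (v a) x := fun x hx => by
    rw [bracket_v ha _ (ne_of_mem_right ha hx), q2 x hx, solve]; ring
  have m2 : a 2 ∈ Icc (a 1) (a 3) := ⟨h12.le, h23.le⟩
  refine ⟨isMaxFun_solve ha hg c, ?_, ?_, ⟨-∫ t in (a 1)..(a 2), g t, ?_, ?_⟩,
    ⟨c - ∫ t in (a 1)..(a 2), v a t * g t, ?_, ?_⟩⟩
  · have h := ((cG _ (left_mem_Icc.2 h13.le)).mono_left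
      (nhdsWithin_le_of_mem (mem_of_superset n1 s1))).neg
    simp only [intervalIntegral.integral_same, neg_zero] at h
    exact h.congr' (mem_of_superset n1 u1)
  · have h := ((cG _ (right_mem_Icc.2 h13.le)).mono_left
      (nhdsWithin_le_of_mem (mem_of_superset n4 s2))).neg
    simp only [h0, neg_zero] at h
    exact h.congr' (mem_of_superset n4 u2)
  · exact ((cG _ m2).mono_left (nhdsWithin_le_of_mem (mem_of_superset n2 s1))).neg.congr'
      (mem_of_superset n2 u1)
  · exact ((cG _ m2).mono_left (nhdsWithin_le_of_mem (mem_of_superset n3 s2))).neg.congr'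
      (mem_of_superset n3 u2)
  · exact (((cA _ m2).mono_left
      (nhdsWithin_le_of_mem (mem_of_superset n2 s1))).const_sub c).congr' (mem_of_superset n2 v1)
  · exact (((cA _ m2).mono_left
      (nhdsWithin_le_of_mem (mem_of_superset n3 s2))).const_sub c).congr' (mem_of_superset n3 v2)

/-! ### Every function of `D(L_S)` comes from the solution operator -/

theorem memLp_mu_of_intervals {a : Fin 4 → ℝ} {f : ℝ → ℂ}
    (h1 : MemLp f 2 (volume.restrict (Ioo (a 1) (a 2))))
    (h2 : MemLp f 2 (volume.restrict (Ioo (a 2) (a 3)))) : MemLp f 2 (mu a) := by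
  have hle : mu a ≤ volume.restrict (Ioo (a 1) (a 2)) + volume.restrict (Ioo (a 2) (a 3)) := by
    rw [← Measure.restrict_eq_self_of_ae_mem (ae_mem_intervals a),
      Measure.restrict_restrict (measurableSet_Ioo.union measurableSet_Ioo)]
    exact (Measure.restrict_mono inter_subset_left le_rfl).trans (Measure.restrict_union_le _ _)
  refine MemLp.mono_measure hle ?_
  rw [memLp_two_iff_integrable_sq_norm (h1.1.add_measure h2.1)]
  exact ((memLp_two_iff_integrable_sq_norm h1.1).1 h1).add_measure
    ((memLp_two_iff_integrable_sq_norm h2.1).1 h2)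

theorem IsMaxFunOn.hasDerivAt {a : Fin 4 → ℝ} {α β : ℝ} {ψ : ℝ → ℂ}
    (hP : ∀ x ∈ Ioo α β, P a x ≠ 0) (h : IsMaxFunOn a α β ψ) {x : ℝ} (hx : x ∈ Ioo α β) :
    HasDerivAt ψ ((P a x : ℂ)⁻¹ * quasiDeriv a ψ x) x := by
  have : (P a x : ℂ) ≠ 0 := by exact_mod_cast hP x hx
  rw [quasiDeriv, inv_mul_cancel_left₀ this]
  exact (h.differentiableAt hP hx).hasDerivAt

/-- On each of the intervals, `ψ - v P ψ'` is a primitive of `-v (P ψ')'`. -/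
theorem IsMaxFunOn.sub_v_mul {a : Fin 4 → ℝ} (ha : StrictMono a) {α β : ℝ} {ψ : ℝ → ℂ}
    (hI : ∀ x ∈ Ioo α β, ∀ i, x ≠ a i) (h : IsMaxFunOn a α β ψ) :
    ACLoc (fun x => ψ x - v a x * quasiDeriv a ψ x) α β ∧
    ∀ᵐ x, x ∈ Ioo α β → HasDerivAt (fun x => ψ x - v a x * quasiDeriv a ψ x)
      (-(v a x * deriv (quasiDeriv a ψ) x)) x := by
  refine ⟨h.ac.sub ((aCLoc_v ha hI).mul h.ac_quasiDeriv), ?_⟩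
  filter_upwards [h.ac_quasiDeriv.ae_differentiableAt] with x h1 hx
  have := (h.hasDerivAt (fun y hy => P_ne_zero (hI y hy)) hx).sub
    ((hasDerivAt_v ha (hI x hx)).mul (h1 hx).hasDerivAt)
  rw [sub_add_cancel_left] at this
  exact this

theorem IsMaxFun.memLp_deriv_quasiDeriv {a : Fin 4 → ℝ} {ψ : ℝ → ℂ} (h : IsMaxFun a ψ) :
    MemLp (deriv (quasiDeriv a ψ)) 2 (mu a) := by
  have h1 := h.memLp_diffExpr.sub
    (memLp_potential_mul a (memLp_mu_of_intervals h.left.memLp h.right.memLp))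
  refine h1.ae_eq (Eventually.of_forall fun x => ?_)
  simp [diffExpr]

/-- The functions `P ψ'` and `ψ - v P ψ'` are recovered on each interval from one endpoint limit and
an integrable derivative. The common limits at `a₃` join the two intervals, and the limit at `a₄`
forces the total integral to vanish. -/
theorem IsSFun.eq_solve {a : Fin 4 → ℝ} (ha : StrictMono a) {ψ : ℝ → ℂ} (h : IsSFun a ψ) :
    ∫ t in (a 1)..(a 3), deriv (quasiDeriv a ψ) t = 0 ∧
    ∃ c : ℂ, ∀ᵐ x ∂(mu a), ψ x = c + solve a (deriv (quasiDeriv a ψ)) x := by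
  obtain ⟨h12, h23, h13⟩ := endpoints_lt ha
  have hg := h.max.memLp_deriv_quasiDeriv
  have ig := intervalIntegrable_of_memLp ha hg
  have iv := intervalIntegrable_v_mul ha hg
  have ivn : IntervalIntegrable (fun t => -(v a t * deriv (quasiDeriv a ψ) t)) volume
      (a 1) (a 3) := iv.neg
  have sub : ∀ {f : ℝ → ℂ}, IntervalIntegrable f volume (a 1) (a 3) → ∀ b ∈ Icc (a 1) (a 3),
      ∀ c ∈ Icc (a 1) (a 3), IntervalIntegrable f volume b c := fun hf b hb c hc =>
    hf.mono_set (by rw [uIcc_of_le h13.le]; exact ordConnected_Icc.uIcc_subset hb hc)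
  have m1 : a 1 ∈ Icc (a 1) (a 3) := left_mem_Icc.2 h13.le
  have m2 : a 2 ∈ Icc (a 1) (a 3) := ⟨h12.le, h23.le⟩
  have m3 : a 3 ∈ Icc (a 1) (a 3) := right_mem_Icc.2 h13.le
  have s1 : Ioo (a 1) (a 2) ⊆ Icc (a 1) (a 3) :=
    Ioo_subset_Icc_self.trans (Icc_subset_Icc_right h23.le)
  have s2 : Ioo (a 2) (a 3) ⊆ Icc (a 1) (a 3) :=
    Ioo_subset_Icc_self.trans (Icc_subset_Icc_left h12.le)
  have neg_u : ∀ {F : Filter ℝ} {l : ℂ}, Tendsto (bracket a ψ u) F (𝓝 l) →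
      Tendsto (quasiDeriv a ψ) F (𝓝 (-l)) := fun hF => by
    simpa [funext (bracket_u a ψ)] using hF.neg
  obtain ⟨l, hl, hl'⟩ := h.trans_u
  obtain ⟨m, hm, hm'⟩ := h.trans_v
  have d1 : ∀ᵐ x, x ∈ Ioo (a 1) (a 2) →
      HasDerivAt (quasiDeriv a ψ) (deriv (quasiDeriv a ψ) x) x := by
    filter_upwards [h.max.left.ac_quasiDeriv.ae_differentiableAt] with x hx hxI
      using (hx hxI).hasDerivAt
  have d2 : ∀ᵐ x, x ∈ Ioo (a 2) (a 3) →
      HasDerivAt (quasiDeriv a ψ) (deriv (quasiDeriv a ψ) x) x := by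
    filter_upwards [h.max.right.ac_quasiDeriv.ae_differentiableAt] with x hx hxI
      using (hx hxI).hasDerivAt
  have q1 : ∀ x ∈ Ioo (a 1) (a 2), quasiDeriv a ψ x =
      ∫ t in (a 1)..x, deriv (quasiDeriv a ψ) t := fun x hx => by
    simpa using h.max.left.ac_quasiDeriv.eq_add_integral_of_tendsto_right (sub ig _ m1 _ m2) d1
      (neg_u h.bc_left) hx
  -- The limit of `P ψ'` at `a₃` is computed from the left, so that the integral from `a₂` can be
  -- continued on the right interval.
  have ql : -l = ∫ t in (a 1)..(a 2), deriv (quasiDeriv a ψ) t := by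
    obtain ⟨x, hx⟩ := exists_between h12
    have e := h.max.left.ac_quasiDeriv.eq_sub_integral_of_tendsto_left (sub ig _ m1 _ m2) d1
      (neg_u hl) hx
    rw [← intervalIntegral.integral_add_adjacent_intervals (sub ig _ m1 _ (s1 hx))
      (sub ig _ (s1 hx) _ m2), ← q1 x hx, e]
    ring
  have q2 : ∀ x ∈ Ioo (a 2) (a 3), quasiDeriv a ψ x =
      ∫ t in (a 1)..x, deriv (quasiDeriv a ψ) t := fun x hx => by
    rw [h.max.right.ac_quasiDeriv.eq_add_integral_of_tendsto_right (sub ig _ m2 _ m3) d2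
      (neg_u hl') hx, ql, intervalIntegral.integral_add_adjacent_intervals (sub ig _ m1 _ m2)
      (sub ig _ m2 _ (s2 hx))]
  obtain ⟨w1, w1'⟩ := h.max.left.sub_v_mul ha fun x hx => ne_of_mem_left ha hx
  obtain ⟨w2, w2'⟩ := h.max.right.sub_v_mul ha fun x hx => ne_of_mem_right ha hx
  have hm1 : Tendsto (fun x => ψ x - v a x * quasiDeriv a ψ x) (𝓝[<] (a 2)) (𝓝 m) :=
    hm.congr' (mem_of_superset (Ioo_mem_nhdsLT h12) fun x hx =>
      bracket_v ha ψ (ne_of_mem_left ha hx))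
  have hm2 : Tendsto (fun x => ψ x - v a x * quasiDeriv a ψ x) (𝓝[>] (a 2)) (𝓝 m) :=
    hm'.congr' (mem_of_superset (Ioo_mem_nhdsGT h23) fun x hx =>
      bracket_v ha ψ (ne_of_mem_right ha hx))
  -- The constant is the limit of `ψ - v P ψ'` at `a₂`, reached by integrating back from its value
  -- `m` at `a₃`.
  refine ⟨?_, m + ∫ t in (a 1)..(a 2), v a t * deriv (quasiDeriv a ψ) t, ae_mu_of_intervals
    (Eventually.of_forall fun x hx => ?_) (Eventually.of_forall fun x hx => ?_)⟩
  · obtain ⟨x, hx⟩ := exists_between h23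
    have e := h.max.right.ac_quasiDeriv.eq_sub_integral_of_tendsto_left (sub ig _ m2 _ m3) d2
      (neg_u h.bc_right) hx
    rw [← intervalIntegral.integral_add_adjacent_intervals (sub ig _ m1 _ (s2 hx))
      (sub ig _ (s2 hx) _ m3), ← q2 x hx, e]
    ring
  · have e := w1.eq_sub_integral_of_tendsto_left (sub ivn _ m1 _ m2) w1' hm1 hx
    simp only [intervalIntegral.integral_neg] at e
    rw [solve, ← q1 x hx, ← intervalIntegral.integral_add_adjacent_intervals
      (sub iv _ m1 _ (s1 hx)) (sub iv _ (s1 hx) _ m2)]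
    linear_combination e
  · have e := w2.eq_add_integral_of_tendsto_right (sub ivn _ m2 _ m3) w2' hm2 hx
    simp only [intervalIntegral.integral_neg] at e
    rw [solve, ← q2 x hx, ← intervalIntegral.integral_add_adjacent_intervals
      (sub iv _ m1 _ m2) (sub iv _ m2 _ (s2 hx))]
    linear_combination e

/-! ### Symmetry of the solution operator -/

/-- The function `(∫ v g)(∫ h) - (∫ g)(∫ v h)` is a primitive of the difference of the integrands.
It vanishes at `a₂` trivially and at `a₄` because both total integrals are zero. -/
theorem integral_mul_solve {a : Fin 4 → ℝ} (ha : StrictMono a) {g h : ℝ → ℂ}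
    (hg : MemLp g 2 (mu a)) (hh : MemLp h 2 (mu a)) (g0 : ∫ t in (a 1)..(a 3), g t = 0)
    (h0 : ∫ t in (a 1)..(a 3), h t = 0) :
    ∫ x, solve a g x * h x ∂(mu a) = ∫ x, g x * solve a h x ∂(mu a) := by
  have ig := intervalIntegrable_of_memLp ha hg
  have ih := intervalIntegrable_of_memLp ha hh
  have ivg := intervalIntegrable_v_mul ha hg
  have ivh := intervalIntegrable_v_mul ha hh
  have i1 : Integrable (fun x => g x * solve a h x) (mu a) := hg.integrable_mul (memLp_solve ha hh)
  have i2 : Integrable (fun x => solve a g x * h x) (mu a) := (memLp_solve ha hg).integrable_mul hh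
  have ac := ((ac_primitive ivg left_mem_uIcc).smul (ac_primitive ih left_mem_uIcc)).sub
    ((ac_primitive ig left_mem_uIcc).smul (ac_primitive ivh left_mem_uIcc))
  have key := integral_eq_sub_of_ac (f' := fun x => g x * solve a h x - solve a g x * h x) ac
    (intervalIntegrable_of_integrable_mu ha (i1.sub i2)) (by
      filter_upwards [ig.ae_hasDerivAt_integral, ih.ae_hasDerivAt_integral,
        ivg.ae_hasDerivAt_integral, ivh.ae_hasDerivAt_integral] with x h1 h2 h3 h4 hx
      have := ((h3 hx _ left_mem_uIcc).mul (h2 hx _ left_mem_uIcc)).sub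
        ((h1 hx _ left_mem_uIcc).mul (h4 hx _ left_mem_uIcc))
      refine this.congr_deriv ?_
      simp only [solve]
      ring)
  simp only [Pi.sub_apply, Pi.mul_apply, smul_eq_mul, g0, h0, intervalIntegral.integral_same,
    mul_zero, zero_mul, sub_self] at key
  rw [← integral_mu ha, integral_sub i1 i2] at key
  exact (sub_eq_zero.1 key).symm

theorem conj_solve (a : Fin 4 → ℝ) (g : ℝ → ℂ) (x : ℝ) :
    (starRingEnd ℂ) (solve a g x) = solve a (fun t => (starRingEnd ℂ) (g t)) x := by
  have hc : ∀ f : ℝ → ℂ, (starRingEnd ℂ) (∫ t in (a 1)..x, f t) =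
      ∫ t in (a 1)..x, (starRingEnd ℂ) (f t) := fun f => by
    simp only [intervalIntegral, map_sub, integral_conj]
  simp only [solve, map_sub, map_mul, hc, conj_v]

/-! ### A criterion for self-adjointness -/

/-- An operator with graph `{(c e + K g, g + Q (c e + K g)) | g ⊥ e}`, where `Q` is symmetric and
`K` is symmetric on the orthogonal complement of `e`, is densely defined and self-adjoint. -/
theorem dense_and_isSelfAdjoint_of_graph {E : Type*} [NormedAddCommGroup E]
    [InnerProductSpace ℂ E] [CompleteSpace E] (A : E →ₗ.[ℂ] E) (e : E) (K Q : E → E)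
    (hQ : ∀ f g, inner ℂ (Q f) g = inner ℂ f (Q g))
    (hK : ∀ g h, inner ℂ e g = 0 → inner ℂ e h = 0 → inner ℂ (K g) h = inner ℂ g (K h))
    (hA : ∀ p q, (p, q) ∈ A.graph ↔ ∃ (c : ℂ) (g : E), inner ℂ e g = 0 ∧ p = c • e + K g ∧
      q = g + Q p) :
    Dense (A.domain : Set E) ∧ IsSelfAdjoint A := by
  have hmem : ∀ (c : ℂ) g, inner ℂ e g = 0 →
      (c • e + K g, g + Q (c • e + K g)) ∈ A.graph := fun c g hg =>
    (hA _ _).2 ⟨c, g, hg, rfl, rfl⟩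
  -- The line spanned by `e` is its own double orthogonal complement.
  have hspan : ∀ x : E, (∀ g, inner ℂ e g = 0 → inner ℂ g x = 0) → ∃ c : ℂ, x = c • e := by
    intro x hx
    have : x ∈ (ℂ ∙ e)ᗮᗮ := (Submodule.mem_orthogonal _ _).2 fun g hg =>
      hx g (Submodule.mem_orthogonal_singleton_iff_inner_right.1 hg)
    rw [Submodule.orthogonal_orthogonal] at this
    obtain ⟨c, hc⟩ := Submodule.mem_span_singleton.1 this
    exact ⟨c, hc.symm⟩
  -- Both density and self-adjointness reduce to this: it is the adjoint relation of `c e + K g ↦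
  -- g`, the operator with `Q` removed.
  have hdata : ∀ y x : E, (∀ (c : ℂ) g, inner ℂ e g = 0 →
      inner ℂ g x = inner ℂ (c • e + K g) y) →
      inner ℂ e y = 0 ∧ ∃ c : ℂ, x = c • e + K y := by
    intro y x h
    have h0 : inner ℂ e y = 0 := by
      -- `K` is not assumed linear, so `K 0` is eliminated by comparing `c = 1` with `c = 0`.
      have h1 := h 1 0 (inner_zero_right _)
      have h2 := h 0 0 (inner_zero_right _)
      rw [h2, one_smul, zero_smul, zero_add, inner_add_left] at h1
      simpa using h1
    refine ⟨h0, ?_⟩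
    obtain ⟨c, hc⟩ := hspan (x - K y) fun g hg => by
      have h1 := h 0 g hg
      rw [zero_smul, zero_add, hK g y hg h0] at h1
      rw [inner_sub_right, h1, sub_self]
    exact ⟨c, by rw [← hc, sub_add_cancel]⟩
  -- Symmetry alone gives this, since `Q 0` is orthogonal to itself.
  have hQ0 : Q 0 = 0 := by
    have := hQ 0 (Q 0)
    rwa [inner_zero_left, inner_self_eq_zero] at this
  have hdense : Dense (A.domain : Set E) := by
    rw [Submodule.dense_iff_topologicalClosure_eq_top,
      Submodule.topologicalClosure_eq_top_iff, Submodule.eq_bot_iff]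
    intro y hy
    rw [Submodule.mem_orthogonal] at hy
    -- A vector `y` orthogonal to the domain satisfies the relation with `x = 0`. Then `(0, y)` lies
    -- in the graph of `A`, which is single-valued, so `y = 0`.
    obtain ⟨h0, c, hc⟩ := hdata y 0 fun c g hg => by
      rw [inner_zero_right, hy _ (LinearPMap.mem_domain_of_mem_graph (hmem c g hg))]
    have := hmem c y h0
    rw [← hc, hQ0, add_zero] at this
    exact A.graph_fst_eq_zero_snd this rfl
  refine ⟨hdense, ?_⟩
  rw [LinearPMap.isSelfAdjoint_def]
  refine LinearPMap.eq_of_eq_graph ?_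
  rw [LinearPMap.adjoint_graph_eq_graph_adjoint hdense]
  ext ⟨x, y⟩
  rw [Submodule.mem_adjoint_iff]
  constructor
  · intro h
    -- Symmetry moves `Q` onto `x`, so the adjoint relation for `(x, y)` becomes the one without `Q`
    -- for `y - Q x`.
    obtain ⟨h0, c, hc⟩ := hdata (y - Q x) x fun c g hg => by
      have h1 := h _ _ (hmem c g hg)
      rw [inner_add_left, hQ] at h1
      rw [inner_sub_right]
      linear_combination h1
    exact (hA _ _).2 ⟨c, y - Q x, h0, hc, by rw [sub_add_cancel]⟩
  · intro h p q hpq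
    obtain ⟨c, g, hg, hp, hq⟩ := (hA _ _).1 hpq
    obtain ⟨d, h, hh, hx, hy⟩ := (hA _ _).1 h
    have hge : inner ℂ g e = 0 := inner_eq_zero_symm.1 hg
    simp only
    rw [hy, hq, inner_add_left, inner_add_right, hQ, hx, hp]
    simp only [inner_add_left, inner_add_right, inner_smul_left, inner_smul_right, hge, hh,
      hK g h hg hh]
    ring

/-! ### The operator `L_S` -/

/-- The function `1` as an element of `L²`. -/
noncomputable def oneL (a : Fin 4 → ℝ) : H a := (memLp_const (1 : ℂ)).toLp fun _ => 1

/-- Multiplication by `2 (x - σ)²`. -/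
noncomputable def potentialL (a : Fin 4 → ℝ) (f : H a) : H a :=
  (memLp_potential_mul a (Lp.memLp f)).toLp _

/-- The operator `solve` in `L²`. -/
noncomputable def solveL {a : Fin 4 → ℝ} (ha : StrictMono a) (f : H a) : H a :=
  (memLp_solve ha (Lp.memLp f)).toLp _

theorem inner_oneL {a : Fin 4 → ℝ} (ha : StrictMono a) (g : H a) :
    inner ℂ (oneL a) g = ∫ t in (a 1)..(a 3), g t := by
  rw [L2.inner_def, ← integral_mu ha]
  refine integral_congr_ae ?_
  filter_upwards [(memLp_const (μ := mu a) (p := 2) (1 : ℂ)).coeFn_toLp] with x hx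
  rw [oneL, hx]
  simp

theorem inner_potentialL (a : Fin 4 → ℝ) (f g : H a) :
    inner ℂ (potentialL a f) g = inner ℂ f (potentialL a g) := by
  rw [L2.inner_def, L2.inner_def]
  refine integral_congr_ae ?_
  filter_upwards [(memLp_potential_mul a (Lp.memLp f)).coeFn_toLp,
    (memLp_potential_mul a (Lp.memLp g)).coeFn_toLp] with x h1 h2
  rw [potentialL, potentialL, h1, h2]
  simp only [RCLike.inner_apply, map_mul, map_pow, map_sub, Complex.conj_ofReal, map_ofNat]
  ring

/-- Since `v` is real, conjugation passes through `solve`, and the bilinear identity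
`integral_mul_solve` applies to the conjugate of `g` and `h`. -/
theorem inner_solveL {a : Fin 4 → ℝ} (ha : StrictMono a) (g h : H a)
    (hg : inner ℂ (oneL a) g = 0) (hh : inner ℂ (oneL a) h = 0) :
    inner ℂ (solveL ha g) h = inner ℂ g (solveL ha h) := by
  rw [inner_oneL ha] at hg hh
  have hg' : ∫ t in (a 1)..(a 3), (starRingEnd ℂ) (g t) = 0 := by
    rw [← integral_mu ha, integral_conj, integral_mu ha, hg, map_zero]
  have e1 : inner ℂ (solveL ha g) h =
      ∫ x, solve a (fun t => (starRingEnd ℂ) (g t)) x * h x ∂(mu a) := by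
    rw [L2.inner_def]
    refine integral_congr_ae ?_
    filter_upwards [(memLp_solve ha (Lp.memLp g)).coeFn_toLp] with x h1
    rw [solveL, h1, RCLike.inner_apply, conj_solve, mul_comm]
  have e2 : inner ℂ g (solveL ha h) =
      ∫ x, (starRingEnd ℂ) (g x) * solve a h x ∂(mu a) := by
    rw [L2.inner_def]
    refine integral_congr_ae ?_
    filter_upwards [(memLp_solve ha (Lp.memLp h)).coeFn_toLp] with x h1
    rw [solveL, h1, RCLike.inner_apply, mul_comm]
  rw [e1, e2]
  exact integral_mul_solve ha (Lp.memLp g).star (Lp.memLp h) hg' hh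

theorem mem_graph_opS {a : Fin 4 → ℝ} (ha : StrictMono a) (p q : H a) :
    (p, q) ∈ (opS a ha).graph ↔ ∃ ψ, IsSFun a ψ ∧ p =ᵐ[mu a] ψ ∧ q =ᵐ[mu a] diffExpr a ψ := by
  have hval : ∀ (y : (opS a ha).domain) ψ, IsSFun a ψ → (y : H a) =ᵐ[mu a] ψ →
      opS a ha y =ᵐ[mu a] diffExpr a ψ := fun y ψ hψ h =>
    maxVal_ae (Submodule.inclusion inf_le_right y : maxDomain a ha) hψ.max h
  rw [LinearPMap.mem_graph_iff]
  constructor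
  · rintro ⟨y, rfl, rfl⟩
    obtain ⟨ψ, hψ, h⟩ : (y : H a) ∈ sDomain a ha := (opS_domain a ha).le y.2
    exact ⟨ψ, hψ, h, hval y ψ hψ h⟩
  · rintro ⟨ψ, hψ, h1, h2⟩
    have hp : p ∈ (opS a ha).domain := by
      rw [opS_domain]; exact ⟨ψ, hψ, h1⟩
    exact ⟨⟨p, hp⟩, rfl, Lp.ext ((hval ⟨p, hp⟩ ψ hψ h1).trans h2.symm)⟩

theorem coeFn_smul_one_add_solveL {a : Fin 4 → ℝ} (ha : StrictMono a) (c : ℂ) (g : H a) :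
    (c • oneL a + solveL ha g : H a) =ᵐ[mu a] fun x => c + solve a g x := by
  filter_upwards [Lp.coeFn_add (c • oneL a) (solveL ha g), Lp.coeFn_smul c (oneL a),
    (memLp_const (μ := mu a) (p := 2) (1 : ℂ)).coeFn_toLp,
    (memLp_solve ha (Lp.memLp g)).coeFn_toLp] with x h1 h2 h3 h4
  rw [h1, Pi.add_apply, h2, Pi.smul_apply, oneL, h3, solveL, h4, smul_eq_mul, mul_one]

theorem solve_congr {a : Fin 4 → ℝ} {g h : ℝ → ℂ} (e : g =ᵐ[mu a] h) {x : ℝ}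
    (hx : x ∈ Ioo (a 1) (a 3)) : solve a g x = solve a h x := by
  have e' : ∀ᵐ t, t ∈ uIoc (a 1) x → g t = h t := by
    rw [EventuallyEq, ae_restrict_iff' measurableSet_Ioo] at e
    filter_upwards [e] with t ht htI
    rw [uIoc_of_le hx.1.le] at htI
    exact ht ⟨htI.1, htI.2.trans_lt hx.2⟩
  have ev : ∀ᵐ t, t ∈ uIoc (a 1) x → v a t * g t = v a t * h t := by
    filter_upwards [e'] with t ht htI
    rw [ht htI]
  rw [solve, solve, intervalIntegral.integral_congr_ae e', intervalIntegral.integral_congr_ae ev]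

/-- This brings `L_S` into the form required by the abstract criterion, with `g` the class of `(P
ψ')'`. The integral condition on `g` is orthogonality to `1`. -/
theorem graph_opS {a : Fin 4 → ℝ} (ha : StrictMono a) (p q : H a) :
    (p, q) ∈ (opS a ha).graph ↔ ∃ (c : ℂ) (g : H a), inner ℂ (oneL a) g = 0 ∧
      p = c • oneL a + solveL ha g ∧ q = g + potentialL a p := by
  rw [mem_graph_opS]
  constructor
  · rintro ⟨ψ, hψ, h1, h2⟩
    have hg := hψ.max.memLp_deriv_quasiDeriv
    obtain ⟨h0, c, hc⟩ := hψ.eq_solve ha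
    refine ⟨c, hg.toLp _, ?_, Lp.ext ?_, Lp.ext ?_⟩
    · rw [inner_oneL ha, ← integral_mu ha, integral_congr_ae hg.coeFn_toLp, integral_mu ha, h0]
    · filter_upwards [h1, hc, coeFn_smul_one_add_solveL ha c (hg.toLp _),
        ae_restrict_mem measurableSet_Ioo] with x e1 e2 e3 hx
      rw [e1, e2, e3, solve_congr hg.coeFn_toLp hx]
    · filter_upwards [h1, h2, Lp.coeFn_add (hg.toLp _) (potentialL a p), hg.coeFn_toLp,
        (memLp_potential_mul a (Lp.memLp p)).coeFn_toLp] with x e1 e2 e3 e4 e5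
      rw [e3, Pi.add_apply, e2, e4, potentialL, e5, e1, diffExpr]
  · rintro ⟨c, g, hg, hp, rfl⟩
    rw [inner_oneL ha] at hg
    have hp' : p =ᵐ[mu a] fun x => c + solve a g x := hp ▸ coeFn_smul_one_add_solveL ha c g
    refine ⟨fun x => c + solve a g x, isSFun_solve ha (Lp.memLp g) hg c, hp', ?_⟩
    filter_upwards [diffExpr_solve ha (Lp.memLp g) c, hp', Lp.coeFn_add g (potentialL a p),
      (memLp_potential_mul a (Lp.memLp p)).coeFn_toLp] with x e1 e2 e3 e4
    rw [e1, e3, Pi.add_apply, potentialL, e4, e2]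

/-! ### The minimal operator -/

theorem bracket_eq_zero_of_eventuallyEq_zero (a : Fin 4 → ℝ) {f : ℝ → ℂ} (w : ℝ → ℂ) {x : ℝ}
    (h : f =ᶠ[𝓝 x] 0) : bracket a f w x = 0 := by
  have h1 : f x = 0 := h.eq_of_nhds
  have h2 : deriv f x = 0 := by rw [h.deriv_eq]; simp
  simp [bracket, h1, h2]

theorem tendsto_bracket_of_support {a : Fin 4 → ℝ} {α β c : ℝ} {f : ℝ → ℂ} (w : ℝ → ℂ)
    {F : Filter ℝ} (hs : closure (Function.support f ∩ Ioo α β) ⊆ Ioo α β) (hc : c ∉ Ioo α β)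
    (hF : F ≤ 𝓝 c) (hI : Ioo α β ∈ F) : Tendsto (bracket a f w) F (𝓝 0) := by
  refine tendsto_const_nhds.congr' ?_
  -- The endpoint lies outside the closed support, so `f` vanishes near every point of the interval
  -- close to that endpoint.
  have hU : (closure (Function.support f ∩ Ioo α β))ᶜ ∈ F :=
    hF (isClosed_closure.isOpen_compl.mem_nhds fun h => hc (hs h))
  filter_upwards [hU, hI] with x hx hxI
  refine (bracket_eq_zero_of_eventuallyEq_zero a w ?_).symm
  filter_upwards [isClosed_closure.isOpen_compl.mem_nhds hx, Ioo_mem_nhds hxI.1 hxI.2]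
    with y hy hyI
  by_contra h
  exact hy (subset_closure ⟨h, hyI⟩)

theorem IsMinFun.isSFun {a : Fin 4 → ℝ} (ha : StrictMono a) {ψ : ℝ → ℂ} (h : IsMinFun a ψ) :
    IsSFun a ψ := by
  obtain ⟨h12, h23, h13⟩ := endpoints_lt ha
  have l2 : ∀ w, Tendsto (bracket a ψ w) (𝓝[<] (a 2)) (𝓝 0) := fun w =>
    tendsto_bracket_of_support w h.supp_left right_notMem_Ioo nhdsWithin_le_nhds
      (Ioo_mem_nhdsLT h12)
  have r2 : ∀ w, Tendsto (bracket a ψ w) (𝓝[>] (a 2)) (𝓝 0) := fun w =>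
    tendsto_bracket_of_support w h.supp_right left_notMem_Ioo nhdsWithin_le_nhds
      (Ioo_mem_nhdsGT h23)
  exact ⟨h.max,
    tendsto_bracket_of_support u h.supp_left left_notMem_Ioo nhdsWithin_le_nhds
      (Ioo_mem_nhdsGT h12),
    tendsto_bracket_of_support u h.supp_right right_notMem_Ioo nhdsWithin_le_nhds
      (Ioo_mem_nhdsLT h23), ⟨0, l2 u, r2 u⟩, ⟨0, l2 _, r2 _⟩⟩

theorem minOp_le_opS {a : Fin 4 → ℝ} (ha : StrictMono a) : minOp a ha ≤ opS a ha := by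
  refine ⟨?_, fun x y hxy => ?_⟩
  · rw [minOp_domain, opS_domain]
    rintro f ⟨ψ, hψ, h⟩
    exact ⟨ψ, hψ.isSFun ha, h⟩
  · exact congrArg (maxOp a ha) (Subtype.ext hxy)

end TwoIntervalSL

theorem mainTheorem7 (a : Fin 4 → ℝ) (ha : StrictMono a) :
    TwoIntervalSL.IsMaxFun a TwoIntervalSL.u ∧
    TwoIntervalSL.IsMaxFun a (TwoIntervalSL.v a) ∧
    TwoIntervalSL.minOp a ha ≤ TwoIntervalSL.opS a ha ∧
    (TwoIntervalSL.minOp a ha).closure ≤ TwoIntervalSL.opS a ha ∧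
    Dense ((TwoIntervalSL.opS a ha).domain : Set (TwoIntervalSL.H a)) ∧
    IsSelfAdjoint (TwoIntervalSL.opS a ha) := by
  obtain ⟨hdense, hself⟩ := TwoIntervalSL.dense_and_isSelfAdjoint_of_graph
    (TwoIntervalSL.opS a ha) (TwoIntervalSL.oneL a) (TwoIntervalSL.solveL ha)
    (TwoIntervalSL.potentialL a) (TwoIntervalSL.inner_potentialL a)
    (TwoIntervalSL.inner_solveL ha) (TwoIntervalSL.graph_opS ha)
  have hle := TwoIntervalSL.minOp_le_opS ha
  -- A self-adjoint operator is closed, so taking closures preserves the inclusion of `L_min` in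
  -- `L_S`.
  have hcl : (TwoIntervalSL.opS a ha).closure = TwoIntervalSL.opS a ha := by
    refine LinearPMap.eq_of_eq_graph ?_
    rw [← hself.isClosed.isClosable.graph_closure_eq_closure_graph]
    exact IsClosed.submodule_topologicalClosure_eq hself.isClosed
  exact ⟨TwoIntervalSL.isMaxFun_u a, TwoIntervalSL.isMaxFun_v ha, hle,
    (LinearPMap.IsClosable.closure_mono hself.isClosed.isClosable hle).trans_eq hcl,
    hdense, hself⟩
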